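/- Let $\mathbb T^2=\mathbb R^2/\mathbb Z^2$ be the unit two-dimensional torus and let $\|\cdot\|_p$ be the norm of $L_p(\mathbb T^2)$ (vectors and tensors are measured pointwise by the Euclidean norm of their entries). Let $T\in(0,\infty]$, and let $(\rho,v)$, with pressure $P$, be a smooth solution on $[0,T)\times\mathbb T^2$ of the inhomogeneous incompressible Navier–Stokes system with viscosity one, $$\rho_t+v\cdot\nabla\rho=0,\qquad \rho v_t+\rho\, v\cdot\nabla v-\Delta v+\nabla P=0,\qquad \operatorname{div} v=0,$$ with values $\rho(t,x)\in\mathbb R$, $v(t,x)\in\mathbb R^2$, $P(t,x)\in\mathbb R$. Put $\rho_0=\rho(0,\cdot)$, $v_0=v(0,\cdot)$, and suppose that $0\le\rho\le\rho^*$ on $[0,T)\times\mathbb T^2$ for some constant $\rho^*$ and that $M:=\int_{\mathbb T^2}\rho_0\,dx>0$. (i) There is a constant $C_0$, depending only on $M$, $\|\rho_0\|_2$, $\|\sqrt{\rho_0}\,v_0\|_2$ and $\rho^*$, such that for all $t\in[0,T)$, $$\|\nabla v(t)\|_2^2+\frac12\int_0^t\Bigl(\|\sqrt\rho\,v_t\|_2^2+\frac1{\rho^*}\bigl(\|\nabla^2v\|_2^2+\|\nabla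 P\|_2^2\bigr)\Bigr)d\tau\le\bigl(e+\|\nabla v_0\|_2^2\bigr)^{\exp\{C_0\|\sqrt{\rho_0}\,v_0\|_2^2\}}-e .$$ (ii) For every $p\in[1,\infty)$ there is a constant $C_p$, depending only on $p$, such that for all $t\in[0,T)$, $$\|v(t)\|_p\le\frac1M\Bigl|\int_{\mathbb T^2}\rho_0v_0\,dx\Bigr|+C_p\Bigl(1+\frac{\|M-\rho_0\|_2}{M}\Bigr)\|\nabla v(t)\|_2 .$$ -/

import Mathlib

open MeasureTheory
open scoped ContDiff ENNReal

noncomputable section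

namespace INS

/-- The plane `ℝ²` with its Euclidean norm. Functions on the unit torus `𝕋² = ℝ²/ℤ²` are
represented by functions on the plane that have period one in each coordinate. -/
abbrev Plane : Type := EuclideanSpace ℝ (Fin 2)

/-- `k`-th vector of the canonical basis. -/
def e (k : Fin 2) : Plane := EuclideanSpace.single k 1

/-- Period one in each of the two coordinates. -/
def IsPeriodic {F : Type*} (f : Plane → F) : Prop :=
  ∀ (k : Fin 2) (x : Plane), f (x + e k) = f x

/-- Lebesgue measure on the unit cell, that is, the normalized measure of the torus. -/
def torus : Measure Plane := volume.restrict {x | ∀ k, x k ∈ Set.Ico (0 : ℝ) 1}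

/-- Partial derivative of a scalar function in the direction of the `k`-th coordinate. -/
def pd (k : Fin 2) (f : Plane → ℝ) (x : Plane) : ℝ := fderiv ℝ f x (e k)

/-- Gradient `(∂₀ f, ∂₁ f)` of a scalar function. -/
def grad (f : Plane → ℝ) (x : Plane) : Plane := WithLp.toLp 2 fun k => pd k f x

/-- Gradient `(∂ⱼ uᵢ)` of a vector field; its norm is the Euclidean one of the four entries. -/
def gradV (u : Plane → Plane) (x : Plane) : EuclideanSpace ℝ (Fin 2 × Fin 2) :=
  WithLp.toLp 2 fun a => pd a.2 (fun y => u y a.1) x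

/-- Second derivatives `(∂ₖ ∂ⱼ uᵢ)` of a vector field, again with the Euclidean norm. -/
def hessV (u : Plane → Plane) (x : Plane) : EuclideanSpace ℝ (Fin 2 × Fin 2 × Fin 2) :=
  WithLp.toLp 2 fun a => pd a.2.2 (pd a.2.1 fun y => u y a.1) x

/-- Divergence of a vector field. -/
def divg (u : Plane → Plane) (x : Plane) : ℝ := ∑ k, pd k (fun y => u y k) x

/-- Laplacian of a scalar function. -/
def lap (f : Plane → ℝ) (x : Plane) : ℝ := ∑ k, pd k (pd k f) x

/-- Time derivative. At interior times of the interval of existence it is two-sided. -/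
def dt {F : Type*} [NormedAddCommGroup F] [NormedSpace ℝ F] (f : ℝ → Plane → F) (t : ℝ)
    (x : Plane) : F := deriv (fun s => f s x) t

/-- `(ρ, v)`, with pressure `P`, is a smooth solution on `[0,T) × 𝕋²` of the inhomogeneous
incompressible Navier-Stokes system with viscosity one. The functions `ρ` and `v` are smooth up
to and including the time zero, so that asking for the equations on the open time interval is the
same as asking for them on `[0,T)`. The pressure only has to be differentiable in space; its
gradient is then smooth by the momentum equation. Values at times outside `[0,T)` are irrelevant. -/
structure IsSmoothSolution (T : ℝ) (ρ : ℝ → Plane → ℝ) (v : ℝ → Plane → Plane)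
    (P : ℝ → Plane → ℝ) : Prop where
  smooth_density : ContDiffOn ℝ ∞ (fun z : ℝ × Plane => ρ z.1 z.2) (Set.Ico 0 T ×ˢ Set.univ)
  smooth_velocity : ContDiffOn ℝ ∞ (fun z : ℝ × Plane => v z.1 z.2) (Set.Ico 0 T ×ˢ Set.univ)
  differentiable_pressure : ∀ t ∈ Set.Ioo 0 T, Differentiable ℝ (P t)
  periodic_density : ∀ t ∈ Set.Ico 0 T, IsPeriodic (ρ t)
  periodic_velocity : ∀ t ∈ Set.Ico 0 T, IsPeriodic (v t)
  periodic_pressure : ∀ t ∈ Set.Ioo 0 T, IsPeriodic (P t)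
  /-- `ρ_t + v · ∇ρ = 0`. -/
  transport : ∀ t ∈ Set.Ioo 0 T, ∀ x, dt ρ t x + ∑ j, v t x j * pd j (ρ t) x = 0
  /-- `ρ v_t + ρ v · ∇v - Δv + ∇P = 0`, component by component. -/
  momentum : ∀ t ∈ Set.Ioo 0 T, ∀ x, ∀ i,
    ρ t x * dt v t x i + ρ t x * ∑ j, v t x j * pd j (fun y => v t y i) x
      - lap (fun y => v t y i) x + pd i (P t) x = 0
  /-- `div v = 0`. -/
  incompressible : ∀ t ∈ Set.Ioo 0 T, ∀ x, divg (v t) x = 0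

/-- The norm of `L_p(𝕋²)`, with values in `ℝ`. -/
def normLp (p : ℝ≥0∞) {F : Type*} [NormedAddCommGroup F] (f : Plane → F) : ℝ := lpNorm f p torus

/-- Total initial mass `M = ∫ ρ₀`. -/
def mass (ρ₀ : Plane → ℝ) : ℝ := ∫ x, ρ₀ x ∂torus

/-- `‖√ρ w‖₂` for a density `ρ` and a vector field `w`. -/
def weightedNorm (ρ : Plane → ℝ) (w : Plane → Plane) : ℝ :=
  normLp 2 fun x => Real.sqrt (ρ x) • w x

end INS

end

open MeasureTheory
open scoped ContDiff ENNReal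

noncomputable section

namespace INS

/-! Write X = ‖∇v‖₂², H = ‖∇²v‖₂², A = ‖√ρ v_t‖₂², B = ‖√ρ v·∇v‖₂² and E = ‖√ρ v‖₂². Since the flow
is incompressible, ∫ρ, ∫ρ² and ∫ρv are conserved, and E' = -2X. In particular X is integrable in
time, with ∫X ≤ E(0)/2.

Testing the momentum equation with v_t gives X' = -2∫ρ v_t·(v_t + v·∇v), because v_t is divergence
free and the pressure drops out (`Snapshot.integral_gradient_energy`). Reading the same equation as
a Stokes system, Δv is divergence free and hence orthogonal to ∇P, so H + ‖∇P‖₂² = ‖ρ(v_t + v·∇v)‖₂²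
≤ 2ρ*(A + B) (`Snapshot.integral_stokes`). Everything then rests on B ≤ ρ* ‖v‖_∞² X.

In two dimensions X does not control ‖v‖_∞, but it fails only by a logarithm. `sq_sub_mean_le` is a
Brezis–Gallouët type inequality: |f - mean|² ≲ X(1 + log(1/δ)) + δ√(XH) for every δ in (0,1]. It is
obtained by integrating ∇f over a triangle with apex at the point and cutting at distance δ. The
mean of v is controlled by E and X even where ρ vanishes, since M·mean(v) = ∫ρv + ∫(M-ρ)(v - mean v)
(`integral_mul_eq_mean_add`, `sq_mean_le`). With δ = 1/(e+X) the Hessian is absorbed, and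
`Snapshot.gradient_inequality` yields X' + I/2 ≤ K X (e+X) log(e+X), where I is the dissipation
under the integral.

With Y = e + X + ½∫I this says (log log Y)' ≤ KX = -(K/2)E', so log log Y + (K/2)E is nonincreasing
(`log_log_gronwall`). Two exponentials give the double exponential bound of (i).

For (ii), the same formula for M·mean(v), with ∫ρv conserved, bounds the mean. The deviation from
the mean is bounded by the Sobolev embedding into L^{2n}, proved by iterating the embedding of
W^{1,1} into L² on powers of f (`integral_sub_mean_pow_le`). -/

/-- The point of the plane with given coordinates. -/
def pt (x y : ℝ) : Plane := !₂[x, y]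

@[simp] lemma pt_zero (x y : ℝ) : pt x y 0 = x := rfl

@[simp] lemma pt_one (x y : ℝ) : pt x y 1 = y := rfl

lemma pt_eta (a : Plane) : pt (a 0) (a 1) = a := by
  ext i; fin_cases i <;> rfl

lemma pt_eq (x y : ℝ) : pt x y = x • e 0 + y • e 1 := by
  ext i; fin_cases i <;> simp [pt, e]

lemma pt_add (a b x y : ℝ) : pt a b + pt x y = pt (a + x) (b + y) := by
  ext i; fin_cases i <;> simp [pt]

lemma pt_add_e_zero (x y : ℝ) : pt x y + e 0 = pt (x + 1) y := by
  ext i; fin_cases i <;> simp [pt, e]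

lemma pt_add_e_one (x y : ℝ) : pt x y + e 1 = pt x (y + 1) := by
  ext i; fin_cases i <;> simp [pt, e]

@[fun_prop]
lemma Continuous.pt {X : Type*} [TopologicalSpace X] {f g : X → ℝ} (hf : Continuous f)
    (hg : Continuous g) : Continuous fun x => pt (f x) (g x) := by
  simp only [pt_eq]; fun_prop

/-! ### Integration over the unit cell -/

lemma measurableSet_cell : MeasurableSet {x : Plane | ∀ k, x k ∈ Set.Ico (0 : ℝ) 1} := by
  have : {x : Plane | ∀ k, x k ∈ Set.Ico (0 : ℝ) 1}
      = ⋂ k, (fun x : Plane => x k) ⁻¹' Set.Ico (0 : ℝ) 1 := by ext; simp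
  rw [this]
  refine MeasurableSet.iInter fun k => ?_
  have : Measurable fun x : Plane => x k := by fun_prop
  exact this measurableSet_Ico

/-- The coordinates of the plane as a measurable equivalence with `ℝ × ℝ`. -/
def coords : Plane ≃ᵐ ℝ × ℝ :=
  (MeasurableEquiv.toLp 2 (Fin 2 → ℝ)).symm.trans MeasurableEquiv.finTwoArrow

lemma coords_apply (x : Plane) : coords x = (x 0, x 1) := rfl

lemma measurePreserving_coords : MeasurePreserving coords (volume : Measure Plane) volume :=
  (volume_preserving_finTwoArrow ℝ).comp
    (EuclideanSpace.volume_preserving_symm_measurableEquiv_toLp (Fin 2))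

lemma torus_eq_comap_coords : torus = volume.restrict
    (coords ⁻¹' (Set.Ico (0 : ℝ) 1 ×ˢ Set.Ico (0 : ℝ) 1)) := by
  unfold torus
  congr 1
  ext x
  simp [coords_apply, Fin.forall_fin_two]

instance : IsProbabilityMeasure torus := by
  constructor
  rw [torus_eq_comap_coords, Measure.restrict_apply_univ,
    measurePreserving_coords.measure_preimage_equiv, Measure.volume_eq_prod, Measure.prod_prod]
  simp

/-- The closed unit cell. -/
def closedCell : Set Plane := {x | ∀ k, x k ∈ Set.Icc (0 : ℝ) 1}

lemma isCompact_closedCell : IsCompact closedCell := by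
  have h := (isCompact_univ_pi fun _ : Fin 2 => isCompact_Icc (a := (0 : ℝ)) (b := 1)).image
    (PiLp.continuous_toLp 2 fun _ : Fin 2 => ℝ)
  convert h using 1
  ext x
  constructor
  · intro hx
    exact ⟨x.ofLp, fun k _ => hx k, rfl⟩
  · rintro ⟨y, hy, rfl⟩ k
    exact hy k trivial

lemma ae_mem_closedCell : ∀ᵐ x ∂torus, x ∈ closedCell := by
  refine (ae_restrict_mem measurableSet_cell).mono fun x hx k => ?_
  exact Set.Ico_subset_Icc_self (hx k)

/-- Almost every point of the cell lies in a compact set and the measure is finite, so continuity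
alone settles every integrability question below. -/
lemma memLp_torus {F : Type*} [NormedAddCommGroup F] {f : Plane → F} (hf : Continuous f)
    (p : ℝ≥0∞) : MemLp f p torus := by
  obtain ⟨C, hC⟩ := isCompact_closedCell.exists_bound_of_continuousOn hf.continuousOn
  exact MemLp.of_bound hf.aestronglyMeasurable C (ae_mem_closedCell.mono fun x hx => hC x hx)

lemma integrable_torus {F : Type*} [NormedAddCommGroup F] {f : Plane → F} (hf : Continuous f) :
    Integrable f torus := memLp_one_iff_integrable.1 (memLp_torus hf 1)

lemma integral_torus {f : Plane → ℝ} (hf : Continuous f) :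
    ∫ x, f x ∂torus = ∫ x in (0 : ℝ)..1, ∫ y in (0 : ℝ)..1, f (pt x y) := by
  have h1 : ∫ x, f x ∂torus
      = ∫ z in Set.Ico (0 : ℝ) 1 ×ˢ Set.Ico (0 : ℝ) 1, f (pt z.1 z.2) := by
    rw [torus_eq_comap_coords]
    rw [← measurePreserving_coords.setIntegral_preimage_emb coords.measurableEmbedding]
    simp only [coords_apply, pt_eta]
  have hc : Continuous fun z : ℝ × ℝ => f (pt z.1 z.2) := by fun_prop
  rw [h1, Measure.volume_eq_prod, setIntegral_prod]
  · simp only [intervalIntegral.integral_of_le zero_le_one, integral_Ico_eq_integral_Ioc]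
  · exact (hc.continuousOn.integrableOn_compact (isCompact_Icc.prod isCompact_Icc)).mono_set
      (Set.prod_mono Set.Ico_subset_Icc_self Set.Ico_subset_Icc_self)

lemma intervalIntegral_swap {f : ℝ → ℝ → ℝ} (hf : Continuous fun z : ℝ × ℝ => f z.1 z.2)
    (a b c d : ℝ) :
    ∫ x in a..b, ∫ y in c..d, f x y = ∫ y in c..d, ∫ x in a..b, f x y := by
  refine intervalIntegral_intervalIntegral_swap ?_
  exact ((hf.continuousOn.integrableOn_compact (isCompact_uIcc.prod isCompact_uIcc)).mono_set
      (Set.prod_mono Set.uIoc_subset_uIcc Set.uIoc_subset_uIcc))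

lemma integral_torus' {f : Plane → ℝ} (hf : Continuous f) :
    ∫ x, f x ∂torus = ∫ y in (0 : ℝ)..1, ∫ x in (0 : ℝ)..1, f (pt x y) := by
  rw [integral_torus hf, intervalIntegral_swap (f := fun x y => f (pt x y)) (by fun_prop)]

/-- By Fubini, this reduces to the invariance of the integral of a function of period one over an
interval of length one, applied in each variable. -/
lemma integral_torus_translate {f : Plane → ℝ} (hf : Continuous f) (hp : IsPeriodic f)
    (a : Plane) : ∫ x, f (a + x) ∂torus = ∫ x, f x ∂torus := by
  have hx : ∀ y, Function.Periodic (fun x => f (pt x y)) 1 := fun y x => by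
    simp only [← pt_add_e_zero, hp 0]
  have hy : ∀ x, Function.Periodic (fun y => f (pt x y)) 1 := fun x y => by
    simp only [← pt_add_e_one, hp 1]
  have h1 : ∀ g : ℝ → ℝ, Function.Periodic g 1 → ∀ c, ∫ x in (0 : ℝ)..1, g (c + x)
      = ∫ x in (0 : ℝ)..1, g x := by
    intro g hg c
    rw [intervalIntegral.integral_comp_add_left g c, add_zero, hg.intervalIntegral_add_eq c 0,
      zero_add]
  obtain ⟨b, c, rfl⟩ : ∃ b c, a = pt b c := ⟨_, _, (pt_eta a).symm⟩
  rw [integral_torus (f := fun x => f (pt b c + x)) (by fun_prop), integral_torus' hf]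
  simp only [pt_add]
  rw [← intervalIntegral.integral_congr (fun y _ => h1 _ (hx y) b),
    ← intervalIntegral_swap (f := fun x y => f (pt (b + x) y)) (by fun_prop)]
  exact intervalIntegral.integral_congr (fun x _ => h1 _ (hy _) c)

/-! ### Partial derivatives -/

lemma hasDerivAt_pt_left {f : Plane → ℝ} (hf : Differentiable ℝ f) (x y : ℝ) :
    HasDerivAt (fun s => f (pt s y)) (pd 0 f (pt x y)) x := by
  have h : HasDerivAt (fun s => pt s y) (e 0) x := by
    simp only [pt_eq]
    simpa using ((hasDerivAt_id x).smul_const (e 0)).add_const (y • e 1)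
  exact (hf _).hasFDerivAt.comp_hasDerivAt x h

lemma hasDerivAt_pt_right {f : Plane → ℝ} (hf : Differentiable ℝ f) (x y : ℝ) :
    HasDerivAt (fun s => f (pt x s)) (pd 1 f (pt x y)) y := by
  have h : HasDerivAt (fun s => pt x s) (e 1) y := by
    simp only [pt_eq]
    simpa using ((hasDerivAt_id y).smul_const (e 1)).const_add (x • e 0)
  exact (hf _).hasFDerivAt.comp_hasDerivAt y h

lemma contDiff_pd {f : Plane → ℝ} {m n : WithTop ℕ∞} (hf : ContDiff ℝ n f) (hmn : m + 1 ≤ n)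
    (k : Fin 2) : ContDiff ℝ m (pd k f) := by
  unfold pd
  exact (hf.fderiv_right hmn).clm_apply contDiff_const

lemma continuous_pd {f : Plane → ℝ} (hf : ContDiff ℝ 1 f) (k : Fin 2) : Continuous (pd k f) :=
  (contDiff_pd (m := 0) hf (by simp) k).continuous

lemma isPeriodic_pd {f : Plane → ℝ} (hf : IsPeriodic f) (k : Fin 2) : IsPeriodic (pd k f) := by
  intro j x
  unfold pd
  rw [← fderiv_comp_add_right]
  simp only [hf j]

lemma pd_add {f g : Plane → ℝ} {x : Plane} (hf : DifferentiableAt ℝ f x)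
    (hg : DifferentiableAt ℝ g x) (k : Fin 2) :
    pd k (fun y => f y + g y) x = pd k f x + pd k g x := by
  simp [pd, fderiv_fun_add hf hg]

lemma pd_mul {f g : Plane → ℝ} {x : Plane} (hf : DifferentiableAt ℝ f x)
    (hg : DifferentiableAt ℝ g x) (k : Fin 2) :
    pd k (fun y => f y * g y) x = pd k f x * g x + f x * pd k g x := by
  simp [pd, fderiv_fun_mul hf hg]; ring

lemma pd_pow {f : Plane → ℝ} {x : Plane} (n : ℕ) (hf : DifferentiableAt ℝ f x)
    (k : Fin 2) : pd k (fun y => f y ^ n) x = n * f x ^ (n - 1) * pd k f x := by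
  simp [pd, fderiv_fun_pow n hf]

lemma pd_sub_const {f : Plane → ℝ} (c : ℝ) (k : Fin 2) :
    pd k (fun y => f y - c) = pd k f := by
  funext x
  simp [pd, fderiv_sub_const]

/-- Second derivatives commute. -/
lemma pd_comm {f : Plane → ℝ} (hf : ContDiff ℝ 2 f) (j k : Fin 2) :
    pd j (pd k f) = pd k (pd j f) := by
  funext x
  have hs : IsSymmSndFDerivAt ℝ f x := hf.contDiffAt.isSymmSndFDerivAt (by simp)
  have hd : DifferentiableAt ℝ (fderiv ℝ f) x :=
    ((hf.fderiv_right (m := 1) (by norm_num)).differentiable (by simp)) x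
  have h : ∀ a b : Plane, fderiv ℝ (fun y => fderiv ℝ f y a) x b = fderiv ℝ (fderiv ℝ f) x b a := by
    intro a b
    rw [fderiv_clm_apply hd (by fun_prop)]
    simp
  unfold pd
  rw [h, h, hs.eq]

/-- Partial derivatives of periodic functions have mean zero. -/
lemma integral_pd {f : Plane → ℝ} (hf : ContDiff ℝ 1 f) (hp : IsPeriodic f) (k : Fin 2) :
    ∫ x, pd k f x ∂torus = 0 := by
  have hd : Differentiable ℝ f := hf.differentiable (by simp)
  have hc : ∀ k, Continuous (pd k f) := continuous_pd hf
  fin_cases k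
  · simp only [Fin.zero_eta]
    rw [integral_torus' (hc 0)]
    refine (intervalIntegral.integral_congr (g := fun _ => (0 : ℝ)) fun y _ => ?_).trans (by simp)
    have h0 := hc 0
    dsimp only
    rw [intervalIntegral.integral_eq_sub_of_hasDerivAt (fun x _ => hasDerivAt_pt_left hd x y)
      (by apply Continuous.intervalIntegrable; fun_prop)]
    have := hp 0 (pt 0 y)
    rw [pt_add_e_zero, zero_add] at this
    rw [this, sub_self]
  · simp only [Fin.mk_one]
    rw [integral_torus (hc 1)]
    refine (intervalIntegral.integral_congr (g := fun _ => (0 : ℝ)) fun x _ => ?_).trans (by simp)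
    have h0 := hc 1
    dsimp only
    rw [intervalIntegral.integral_eq_sub_of_hasDerivAt (fun y _ => hasDerivAt_pt_right hd x y)
      (by apply Continuous.intervalIntegrable; fun_prop)]
    have := hp 1 (pt x 0)
    rw [pt_add_e_one, zero_add] at this
    rw [this, sub_self]

/-! ### Cauchy-Schwarz and norms -/

/-- The quadratic polynomial r ↦ ∫(f - r g)² is nonnegative, so its discriminant is not positive. -/
lemma sq_integral_mul_le {α : Type*} [MeasurableSpace α] {μ : Measure α} {f g : α → ℝ}
    (hf : Integrable (fun x => f x ^ 2) μ) (hg : Integrable (fun x => g x ^ 2) μ)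
    (hfg : Integrable (fun x => f x * g x) μ) :
    (∫ x, f x * g x ∂μ) ^ 2 ≤ (∫ x, f x ^ 2 ∂μ) * ∫ x, g x ^ 2 ∂μ := by
  have h : ∀ r : ℝ, 0 ≤ (∫ x, g x ^ 2 ∂μ) * (r * r) + (-2 * ∫ x, f x * g x ∂μ) * r
      + ∫ x, f x ^ 2 ∂μ := by
    intro r
    have : 0 ≤ ∫ x, (f x - r * g x) ^ 2 ∂μ := integral_nonneg fun x => sq_nonneg _
    have h2 : ∫ x, (f x - r * g x) ^ 2 ∂μ
        = ∫ x, (f x ^ 2 - 2 * r * (f x * g x)) + r ^ 2 * g x ^ 2 ∂μ := by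
      congr 1; funext x; ring
    rw [h2, integral_add (by exact hf.sub (hfg.const_mul _)) (hg.const_mul _),
      integral_sub hf (hfg.const_mul _), integral_const_mul, integral_const_mul] at this
    linarith
  have := discrim_le_zero h
  unfold discrim at this
  nlinarith

lemma sq_integral_mul_le_torus {f g : Plane → ℝ} (hf : Continuous f) (hg : Continuous g) :
    (∫ x, f x * g x ∂torus) ^ 2 ≤ (∫ x, f x ^ 2 ∂torus) * ∫ x, g x ^ 2 ∂torus :=
  sq_integral_mul_le (integrable_torus (by fun_prop)) (integrable_torus (by fun_prop))
    (integrable_torus (by fun_prop))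

lemma sq_integral_le_torus {f : Plane → ℝ} (hf : Continuous f) :
    (∫ x, f x ∂torus) ^ 2 ≤ ∫ x, f x ^ 2 ∂torus := by
  simpa using sq_integral_mul_le_torus hf (continuous_const (y := (1 : ℝ)))

lemma sq_intervalIntegral_mul_le {f g : ℝ → ℝ} {a b : ℝ} (hab : a ≤ b)
    (hf : ContinuousOn f (Set.Icc a b)) (hg : ContinuousOn g (Set.Icc a b)) :
    (∫ x in a..b, f x * g x) ^ 2 ≤ (∫ x in a..b, f x ^ 2) * ∫ x in a..b, g x ^ 2 := by
  have h : ∀ {F : ℝ → ℝ}, ContinuousOn F (Set.Icc a b) →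
      Integrable F (volume.restrict (Set.Ioc a b)) := fun hF =>
    (hF.integrableOn_Icc).mono_set Set.Ioc_subset_Icc_self
  simp only [intervalIntegral.integral_of_le hab]
  exact sq_integral_mul_le (h (hf.pow 2)) (h (hg.pow 2)) (h (hf.mul hg))

lemma normLp_two_sq {F : Type*} [NormedAddCommGroup F] {f : Plane → F} (hf : Continuous f) :
    normLp 2 f ^ 2 = ∫ x, ‖f x‖ ^ 2 ∂torus := by
  unfold normLp
  rw [lpNorm_eq_integral_norm_rpow_toReal (by simp) (by simp) hf.aestronglyMeasurable]
  rw [← Real.rpow_natCast, ← Real.rpow_mul (integral_nonneg fun x => by positivity)]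
  simp

/-! ### Functional inequalities on the torus -/

lemma integral_torus_mono {f g : Plane → ℝ} (hf : Continuous f) (hg : Continuous g)
    (h : ∀ x ∈ closedCell, f x ≤ g x) : ∫ x, f x ∂torus ≤ ∫ x, g x ∂torus :=
  integral_mono_ae (integrable_torus hf) (integrable_torus hg)
    (ae_mem_closedCell.mono fun x hx => h x hx)

lemma abs_sub_le_integral_abs_deriv {g g' : ℝ → ℝ} (hg : ∀ x, HasDerivAt g (g' x) x)
    (hc : Continuous g') {x y : ℝ} (hx : x ∈ Set.Icc (0 : ℝ) 1) (hy : y ∈ Set.Icc (0 : ℝ) 1) :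
    |g x - g y| ≤ ∫ s in (0 : ℝ)..1, |g' s| := by
  wlog hxy : y ≤ x generalizing x y
  · rw [abs_sub_comm]
    exact this hy hx (le_of_not_ge hxy)
  rw [← intervalIntegral.integral_eq_sub_of_hasDerivAt (fun s _ => hg s) (hc.intervalIntegrable _ _)]
  refine (intervalIntegral.abs_integral_le_integral_abs hxy).trans ?_
  exact intervalIntegral.integral_mono_interval hy.1 hxy hx.2
    (Filter.Eventually.of_forall fun s => abs_nonneg _) (hc.abs.intervalIntegrable _ _)

lemma abs_sub_integral_le {g : ℝ → ℝ} (hg : Continuous g) {c d : ℝ}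
    (h : ∀ s ∈ Set.Icc (0 : ℝ) 1, |c - g s| ≤ d) : |c - ∫ s in (0 : ℝ)..1, g s| ≤ d := by
  have : c - ∫ s in (0 : ℝ)..1, g s = ∫ s in (0 : ℝ)..1, (c - g s) := by
    rw [intervalIntegral.integral_sub (by simp) (hg.intervalIntegrable _ _)]
    simp
  rw [this]
  have := intervalIntegral.norm_integral_le_of_norm_le_const (a := 0) (b := 1)
    (f := fun s => c - g s) (C := d) (fun s hs => by
      rw [Set.uIoc_of_le zero_le_one] at hs
      exact h s (Set.Ioc_subset_Icc_self hs))
  simpa using this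

/-- Average over s the bound |g x| - |g s| ≤ ∫|g'|. -/
lemma abs_le_integral_add {g g' : ℝ → ℝ} (hg : ∀ x, HasDerivAt g (g' x) x)
    (hc : Continuous g') {x : ℝ} (hx : x ∈ Set.Icc (0 : ℝ) 1) :
    |g x| ≤ (∫ s in (0 : ℝ)..1, |g s|) + ∫ s in (0 : ℝ)..1, |g' s| := by
  have hgc : Continuous g := continuous_iff_continuousAt.2 fun x => (hg x).continuousAt
  have h := abs_sub_integral_le (c := |g x|) (d := ∫ s in (0 : ℝ)..1, |g' s|) hgc.abs fun s hs =>
    (abs_abs_sub_abs_le_abs_sub _ _).trans (abs_sub_le_integral_abs_deriv hg hc hx hs)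
  linarith [abs_le.1 h]

/-! ### Poincaré and Sobolev inequalities by averaging along coordinate lines -/

/-- Average along the horizontal line through a point. -/
def avgLeft (f : Plane → ℝ) (a : Plane) : ℝ := ∫ s in (0 : ℝ)..1, f (pt s (a 1))

/-- Average along the vertical line through a point. -/
def avgRight (f : Plane → ℝ) (a : Plane) : ℝ := ∫ s in (0 : ℝ)..1, f (pt (a 0) s)

lemma continuous_avgLeft {f : Plane → ℝ} (hf : Continuous f) : Continuous (avgLeft f) := by
  unfold avgLeft
  exact intervalIntegral.continuous_parametric_intervalIntegral_of_continuous' (by fun_prop) _ _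

lemma continuous_avgRight {f : Plane → ℝ} (hf : Continuous f) : Continuous (avgRight f) := by
  unfold avgRight
  exact intervalIntegral.continuous_parametric_intervalIntegral_of_continuous' (by fun_prop) _ _

lemma integral_avgLeft {f : Plane → ℝ} (hf : Continuous f) :
    ∫ a, avgLeft f a ∂torus = ∫ a, f a ∂torus := by
  rw [integral_torus' (continuous_avgLeft hf), integral_torus' hf]
  simp [avgLeft]

/-- One factor depends only on the ordinate and the other only on the abscissa, so the double
integral factorizes. This is the Gagliardo–Nirenberg mechanism behind the embedding of W^{1,1} into
L². -/
lemma integral_avgLeft_mul_avgRight {f g : Plane → ℝ} (hf : Continuous f) (hg : Continuous g) :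
    ∫ a, avgLeft f a * avgRight g a ∂torus = (∫ a, f a ∂torus) * ∫ a, g a ∂torus := by
  have h1 := continuous_avgLeft hf
  have h2 := continuous_avgRight hg
  rw [integral_torus' (by fun_prop), integral_torus' hf, integral_torus hg]
  simp [avgLeft, avgRight]

lemma sq_avgLeft_le {f : Plane → ℝ} (hf : Continuous f) (a : Plane) :
    avgLeft f a ^ 2 ≤ avgLeft (fun x => f x ^ 2) a := by
  have hc : Continuous fun s => f (pt s (a 1)) := by fun_prop
  simpa [avgLeft] using sq_intervalIntegral_mul_le zero_le_one hc.continuousOn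
    (continuousOn_const (c := (1 : ℝ)))

/-- Square of the `L²` norm of the gradient of a scalar function. -/
def gradSq (f : Plane → ℝ) : ℝ := ∫ x, pd 0 f x ^ 2 + pd 1 f x ^ 2 ∂torus

/-- Square of the `L²` norm of the Hessian of a scalar function. -/
def hessSq (f : Plane → ℝ) : ℝ :=
  ∫ x, pd 0 (pd 0 f) x ^ 2 + pd 1 (pd 0 f) x ^ 2 + pd 0 (pd 1 f) x ^ 2 + pd 1 (pd 1 f) x ^ 2 ∂torus

lemma gradSq_nonneg (f : Plane → ℝ) : 0 ≤ gradSq f := integral_nonneg fun x => by positivity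

lemma hessSq_nonneg (f : Plane → ℝ) : 0 ≤ hessSq f := integral_nonneg fun x => by positivity

lemma gradSq_eq_add {f : Plane → ℝ} (hf : ContDiff ℝ 1 f) :
    gradSq f = (∫ x, pd 0 f x ^ 2 ∂torus) + ∫ x, pd 1 f x ^ 2 ∂torus := by
  have h := continuous_pd hf
  exact integral_add (integrable_torus ((h 0).pow 2)) (integrable_torus ((h 1).pow 2))

lemma gradSq_sub_const (f : Plane → ℝ) (c : ℝ) : gradSq (fun x => f x - c) = gradSq f := by
  unfold gradSq
  simp only [pd_sub_const]

lemma integral_sq_pd_le_gradSq {f : Plane → ℝ} (hf : ContDiff ℝ 1 f) (k : Fin 2) :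
    ∫ x, pd k f x ^ 2 ∂torus ≤ gradSq f := by
  have h := continuous_pd hf
  refine integral_mono (integrable_torus ((h k).pow 2))
    (integrable_torus (((h 0).pow 2).add ((h 1).pow 2))) fun x => ?_
  fin_cases k
  · simpa using sq_nonneg (pd 1 f x)
  · simpa using sq_nonneg (pd 0 f x)

/-- Poincaré inequality. -/
lemma integral_sq_sub_mean_le {f : Plane → ℝ} (hf : ContDiff ℝ 1 f) :
    ∫ x, (f x - ∫ y, f y ∂torus) ^ 2 ∂torus ≤ 2 * gradSq f := by
  have hd : Differentiable ℝ f := hf.differentiable (by simp)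
  have hfc : Continuous f := hf.continuous
  have h0 := continuous_pd hf 0
  have h1 := continuous_pd hf 1
  have hL := continuous_avgLeft h0.abs
  have hR := continuous_avgRight h1.abs
  -- Pass from the value at a to the average over the horizontal line through a, and from there to
  -- the full mean.
  have key : ∀ a ∈ closedCell, |f a - ∫ y, f y ∂torus|
      ≤ avgLeft (fun x => |pd 0 f x|) a + ∫ x, |pd 1 f x| ∂torus := by
    intro a ha
    have e1 : |f a - avgLeft f a| ≤ avgLeft (fun x => |pd 0 f x|) a := by
      refine abs_sub_integral_le (by fun_prop) fun s hs => ?_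
      have := abs_sub_le_integral_abs_deriv (fun x => hasDerivAt_pt_left hd x (a 1)) (by fun_prop)
        (ha 0) hs
      rwa [pt_eta] at this
    have e2 : |avgLeft f a - ∫ y, f y ∂torus| ≤ ∫ x, |pd 1 f x| ∂torus := by
      have hcR := continuous_avgRight hfc
      -- The ordinate 0 in `avgRight f (pt s 0)` is a dummy, since `avgRight` only sees the
      -- abscissa.
      have : avgLeft f a - ∫ y, f y ∂torus
          = ∫ s in (0 : ℝ)..1, (f (pt s (a 1)) - avgRight f (pt s 0)) := by
        rw [intervalIntegral.integral_sub (Continuous.intervalIntegrable (by fun_prop) _ _)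
          (Continuous.intervalIntegrable (by fun_prop) _ _), integral_torus hfc]
        rfl
      rw [this, integral_torus h1.abs]
      refine (intervalIntegral.abs_integral_le_integral_abs zero_le_one).trans ?_
      refine intervalIntegral.integral_mono_on zero_le_one
        (Continuous.intervalIntegrable (by fun_prop) _ _)
        (Continuous.intervalIntegrable (u := fun x => avgRight (fun z => |pd 1 f z|) (pt x 0))
          (by fun_prop) _ _) fun s hs => ?_
      refine abs_sub_integral_le (by fun_prop) fun r hr => ?_
      exact abs_sub_le_integral_abs_deriv (fun y => hasDerivAt_pt_right hd s y) (by fun_prop)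
        (ha 1) hr
    calc |f a - ∫ y, f y ∂torus| ≤ |f a - avgLeft f a| + |avgLeft f a - ∫ y, f y ∂torus| :=
          abs_sub_le _ _ _
      _ ≤ _ := add_le_add e1 e2
  have hL2 := continuous_avgLeft (f := fun x => |pd 0 f x| ^ 2) (by fun_prop)
  have key2 : ∀ a ∈ closedCell, (f a - ∫ y, f y ∂torus) ^ 2
      ≤ 2 * avgLeft (fun x => |pd 0 f x| ^ 2) a + 2 * ∫ x, |pd 1 f x| ^ 2 ∂torus := by
    intro a ha
    have e1 := sq_avgLeft_le h0.abs a
    have e2 := sq_integral_le_torus h1.abs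
    have e3 := sq_le_sq' (by linarith [abs_nonneg (f a - ∫ y, f y ∂torus), key a ha]) (key a ha)
    rw [sq_abs] at e3
    nlinarith [sq_nonneg (avgLeft (fun x => |pd 0 f x|) a - ∫ x, |pd 1 f x| ∂torus)]
  refine (integral_torus_mono (by fun_prop) (by fun_prop) key2).trans ?_
  rw [integral_add (integrable_torus (by fun_prop)) (integrable_torus (by fun_prop)),
    integral_const_mul, integral_avgLeft (by fun_prop), gradSq_eq_add hf]
  simp only [sq_abs]
  simp
  linarith

/-- The embedding of `W^{1,1}` into `L²`. -/
lemma integral_sq_le_mul {f : Plane → ℝ} (hf : ContDiff ℝ 1 f) :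
    ∫ x, f x ^ 2 ∂torus ≤ ((∫ x, |f x| ∂torus) + ∫ x, |pd 0 f x| ∂torus)
      * ((∫ x, |f x| ∂torus) + ∫ x, |pd 1 f x| ∂torus) := by
  have hd : Differentiable ℝ f := hf.differentiable (by simp)
  have hfc : Continuous f := hf.continuous
  have h0 := continuous_pd hf 0
  have h1 := continuous_pd hf 1
  rw [← integral_add (integrable_torus (by fun_prop)) (integrable_torus (by fun_prop)),
    ← integral_add (integrable_torus (by fun_prop)) (integrable_torus (by fun_prop)),
    ← integral_avgLeft_mul_avgRight (by fun_prop) (by fun_prop)]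
  have hL := continuous_avgLeft (f := fun x => |f x| + |pd 0 f x|) (by fun_prop)
  have hR := continuous_avgRight (f := fun x => |f x| + |pd 1 f x|) (by fun_prop)
  refine integral_torus_mono (by fun_prop) (by fun_prop) fun a ha => ?_
  have e1 := abs_le_integral_add (fun x => hasDerivAt_pt_left hd x (a 1)) (by fun_prop) (ha 0)
  have e2 := abs_le_integral_add (fun y => hasDerivAt_pt_right hd (a 0) y) (by fun_prop) (ha 1)
  rw [pt_eta, ← intervalIntegral.integral_add (Continuous.intervalIntegrable (by fun_prop) _ _)
    (Continuous.intervalIntegrable (by fun_prop) _ _)] at e1 e2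
  rw [← sq_abs, sq]
  exact mul_le_mul e1 e2 (abs_nonneg _) ((abs_nonneg _).trans e1)

lemma integral_abs_mul_le_sqrt {f g : Plane → ℝ} (hf : Continuous f) (hg : Continuous g) :
    ∫ x, |f x * g x| ∂torus ≤ √((∫ x, f x ^ 2 ∂torus) * ∫ x, g x ^ 2 ∂torus) := by
  refine Real.le_sqrt_of_sq_le ?_
  simpa [abs_mul] using sq_integral_mul_le_torus hf.abs hg.abs

/-- The W^{1,1} to L² embedding is applied to f^(n+1). Both f^(n+1) = f^n·f and its gradient (n+1)
f^n ∇f have L¹ norms bounded by Cauchy–Schwarz with f^n as one factor. The contributions 2 and n+1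
add up to n+3. -/
lemma integral_pow_succ_le {f : Plane → ℝ} (hf : ContDiff ℝ 1 f)
    (h2 : ∫ x, f x ^ 2 ∂torus ≤ 2 * gradSq f) (n : ℕ) :
    ∫ x, f x ^ (2 * (n + 1)) ∂torus
      ≤ (n + 3) ^ 2 * gradSq f * ∫ x, f x ^ (2 * n) ∂torus := by
  have hd : Differentiable ℝ f := hf.differentiable (by simp)
  have hfc : Continuous f := hf.continuous
  have hc := continuous_pd hf
  set X := gradSq f
  have hX : 0 ≤ X := gradSq_nonneg f
  set A := ∫ x, f x ^ (2 * n) ∂torus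
  have hA : 0 ≤ A := integral_nonneg fun x => by simp only [Pi.zero_apply, pow_mul]; positivity
  have hAn : ∫ x, (f x ^ n) ^ 2 ∂torus = A := by
    simp only [← pow_mul, mul_comm n 2, A]
  have e1 : ∫ x, |f x ^ (n + 1)| ∂torus ≤ 2 * √(A * X) := by
    have := integral_abs_mul_le_sqrt (f := fun x => f x ^ n) (by fun_prop) hfc
    simp only [pow_succ]
    refine this.trans ?_
    rw [hAn, show (2 : ℝ) * √(A * X) = √(2 ^ 2 * (A * X)) by
      rw [Real.sqrt_mul (x := 2 ^ 2) (by norm_num), Real.sqrt_sq (by norm_num)]]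
    refine Real.sqrt_le_sqrt ?_
    nlinarith [mul_le_mul_of_nonneg_left h2 hA, mul_nonneg hA hX]
  have e2 : ∀ k, ∫ x, |pd k (fun y => f y ^ (n + 1)) x| ∂torus ≤ (n + 1) * √(A * X) := by
    intro k
    have := integral_abs_mul_le_sqrt (f := fun x => f x ^ n) (by fun_prop) (hc k)
    rw [hAn] at this
    have h3 : ∀ x, |pd k (fun y => f y ^ (n + 1)) x| = (n + 1) * |f x ^ n * pd k f x| := by
      intro x
      rw [pd_pow _ (hd x), Nat.add_sub_cancel, mul_assoc, abs_mul]
      push_cast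
      rw [abs_of_nonneg (by positivity)]
    simp only [h3]
    rw [integral_const_mul]
    gcongr
    refine this.trans (Real.sqrt_le_sqrt ?_)
    gcongr
    exact integral_sq_pd_le_gradSq hf k
  have := integral_sq_le_mul (hf.pow (n + 1))
  simp only [← pow_mul] at this
  rw [show 2 * (n + 1) = (n + 1) * 2 by ring]
  refine this.trans ?_
  calc _ ≤ (2 * √(A * X) + (n + 1) * √(A * X)) * (2 * √(A * X) + (n + 1) * √(A * X)) := by
        refine mul_le_mul (add_le_add e1 (e2 0)) (add_le_add e1 (e2 1)) ?_ (by positivity)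
        exact add_nonneg (integral_nonneg fun x => abs_nonneg _)
          (integral_nonneg fun x => abs_nonneg _)
    _ = (n + 3) ^ 2 * √(A * X) ^ 2 := by ring
    _ = _ := by rw [Real.sq_sqrt (by positivity)]; ring

/-- Sobolev embedding into the spaces `L^{2n}`. -/
lemma integral_sub_mean_pow_le {f : Plane → ℝ} (hf : ContDiff ℝ 1 f) (n : ℕ) :
    ∫ x, (f x - ∫ y, f y ∂torus) ^ (2 * n) ∂torus
      ≤ ((n + 2).factorial : ℝ) ^ 2 * gradSq f ^ n := by
  induction n with
  | zero => simp
  | succ n ih =>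
    have hX := gradSq_nonneg f
    have := integral_pow_succ_le (f := fun x => f x - ∫ y, f y ∂torus) (hf.sub contDiff_const)
      (by rw [gradSq_sub_const]; exact integral_sq_sub_mean_le hf) n
    rw [gradSq_sub_const] at this
    refine this.trans ?_
    -- The factors (n+3)² telescope into the square of a factorial.
    calc _ ≤ (n + 3 : ℝ) ^ 2 * gradSq f * (((n + 2).factorial : ℝ) ^ 2 * gradSq f ^ n) := by
          gcongr
      _ = _ := by
          rw [show n + 1 + 2 = (n + 2) + 1 by ring, Nat.factorial_succ (n + 2)]
          push_cast
          ring

/-! ### A logarithmic bound of the supremum -/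

/-- Mean of a function over the intersection of a cone and the vertical line at distance `s`. -/
def coneMean (G : Plane → ℝ) (s : ℝ) : ℝ := ∫ θ in (0 : ℝ)..1, G (pt s (s * θ))

lemma continuous_coneMean {G : Plane → ℝ} (hG : Continuous G) : Continuous (coneMean G) := by
  unfold coneMean
  exact intervalIntegral.continuous_parametric_intervalIntegral_of_continuous' (by fun_prop) _ _

lemma coneMean_nonneg {G : Plane → ℝ} (hG : ∀ x, 0 ≤ G x) (s : ℝ) : 0 ≤ coneMean G s :=
  intervalIntegral.integral_nonneg zero_le_one fun _ _ => hG _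

/-- Substituting y = sθ turns s times the mean into an integral over [0,s], and Cauchy–Schwarz on an
interval of length s gains the factor s. -/
lemma mul_sq_coneMean_le {G g : Plane → ℝ} (hG : Continuous G) (hg : Continuous g)
    (hGg : ∀ x, G x ^ 2 ≤ g x) {s : ℝ} (hs : s ∈ Set.Ioc (0 : ℝ) 1) :
    s * coneMean G s ^ 2 ≤ ∫ y in (0 : ℝ)..1, g (pt s y) := by
  have hc : Continuous fun y => G (pt s y) := by fun_prop
  have e1 : s * coneMean G s = ∫ y in (0 : ℝ)..s, G (pt s y) := by
    have := intervalIntegral.mul_integral_comp_mul_left (a := 0) (b := 1)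
      (f := fun y => G (pt s y)) s
    simpa [coneMean] using this
  have e2 : (s * coneMean G s) ^ 2 ≤ s * ∫ y in (0 : ℝ)..s, G (pt s y) ^ 2 := by
    have := sq_intervalIntegral_mul_le hs.1.le (continuousOn_const (c := (1 : ℝ))) hc.continuousOn
    rw [e1]
    simpa using this
  have e3 : ∫ y in (0 : ℝ)..s, G (pt s y) ^ 2 ≤ ∫ y in (0 : ℝ)..1, g (pt s y) := by
    have h1 : ∫ y in (0 : ℝ)..s, G (pt s y) ^ 2 ≤ ∫ y in (0 : ℝ)..1, G (pt s y) ^ 2 :=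
      intervalIntegral.integral_mono_interval le_rfl hs.1.le hs.2
        (Filter.Eventually.of_forall fun y => sq_nonneg _)
        (Continuous.intervalIntegrable (by fun_prop) _ _)
    refine h1.trans (intervalIntegral.integral_mono_on zero_le_one
      (Continuous.intervalIntegrable (by fun_prop) _ _)
      (Continuous.intervalIntegrable (by fun_prop) _ _) fun y _ => hGg _)
  have h4 : s * (s * coneMean G s ^ 2) ≤ s * ∫ y in (0 : ℝ)..1, g (pt s y) := by
    calc _ = (s * coneMean G s) ^ 2 := by ring
      _ ≤ _ := e2.trans (mul_le_mul_of_nonneg_left e3 hs.1.le)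
  exact le_of_mul_le_mul_left h4 hs.1

/-- Integrate the derivative of f along the rays s ↦ (s, sθ) from the origin to the edge of abscissa
1, and average over the slope θ in [0,1]. -/
lemma abs_sub_integral_cone_le {f : Plane → ℝ} (hf : ContDiff ℝ 1 f) :
    |f (pt 0 0) - ∫ θ in (0 : ℝ)..1, f (pt 1 θ)|
      ≤ ∫ s in (0 : ℝ)..1, coneMean (fun x => |pd 0 f x| + |pd 1 f x|) s := by
  have hd : Differentiable ℝ f := hf.differentiable (by simp)
  have hfc := hf.continuous
  have h0 := continuous_pd hf 0
  have h1 := continuous_pd hf 1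
  have hderiv : ∀ θ s, HasDerivAt (fun s => f (pt s (s * θ)))
      (pd 0 f (pt s (s * θ)) + θ * pd 1 f (pt s (s * θ))) s := by
    intro θ s
    have h : HasDerivAt (fun s => pt s (s * θ)) (e 0 + θ • e 1) s := by
      simp only [pt_eq]
      have := ((hasDerivAt_id s).smul_const (e 0)).add
        (((hasDerivAt_id s).mul_const θ).smul_const (e 1))
      simp only [one_smul, one_mul] at this
      exact this
    have := (hd (pt s (s * θ))).hasFDerivAt.comp_hasDerivAt s h
    rw [map_add, map_smul] at this
    exact this
  have e1 : f (pt 0 0) - ∫ θ in (0 : ℝ)..1, f (pt 1 θ)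
      = ∫ θ in (0 : ℝ)..1, (f (pt 0 0) - f (pt 1 θ)) := by
    rw [intervalIntegral.integral_sub (by simp) (Continuous.intervalIntegrable (by fun_prop) _ _)]
    simp
  have hcG : Continuous fun θ => ∫ s in (0 : ℝ)..1,
      (|pd 0 f (pt s (s * θ))| + |pd 1 f (pt s (s * θ))|) :=
    intervalIntegral.continuous_parametric_intervalIntegral_of_continuous' (by fun_prop) _ _
  unfold coneMean
  rw [e1, intervalIntegral_swap
    (f := fun s θ => |pd 0 f (pt s (s * θ))| + |pd 1 f (pt s (s * θ))|) (by fun_prop)]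
  refine (intervalIntegral.abs_integral_le_integral_abs zero_le_one).trans ?_
  refine intervalIntegral.integral_mono_on zero_le_one
    (Continuous.intervalIntegrable (by fun_prop) _ _) (hcG.intervalIntegrable _ _) fun θ hθ => ?_
  have e2 : f (pt 0 0) - f (pt 1 θ)
      = -∫ s in (0 : ℝ)..1, (pd 0 f (pt s (s * θ)) + θ * pd 1 f (pt s (s * θ))) := by
    rw [intervalIntegral.integral_eq_sub_of_hasDerivAt (fun s _ => hderiv θ s)
      (Continuous.intervalIntegrable (by fun_prop) _ _)]
    simp
  rw [e2, abs_neg]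
  refine (intervalIntegral.abs_integral_le_integral_abs zero_le_one).trans ?_
  refine intervalIntegral.integral_mono_on zero_le_one
    (Continuous.intervalIntegrable (by fun_prop) _ _)
    (Continuous.intervalIntegrable (by fun_prop) _ _) fun s _ => ?_
  refine (abs_add_le _ _).trans ?_
  refine add_le_add_right ?_ _
  rw [abs_mul, abs_of_nonneg hθ.1]
  exact mul_le_of_le_one_left (abs_nonneg _) hθ.2

/-- A trace estimate: it controls the integral over each single vertical line, uniformly in s. It
will be applied to g = |∇f|², where the derivative costs one Hessian. -/
lemma integral_vertical_le {g : Plane → ℝ} (hg : ContDiff ℝ 1 g) {s : ℝ}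
    (hs : s ∈ Set.Icc (0 : ℝ) 1) :
    ∫ y in (0 : ℝ)..1, g (pt s y) ≤ (∫ x, |g x| ∂torus) + ∫ x, |pd 0 g x| ∂torus := by
  have hd : Differentiable ℝ g := hg.differentiable (by simp)
  have hgc := hg.continuous
  have h0 := continuous_pd hg 0
  have hL := continuous_avgLeft hgc.abs
  have hL0 := continuous_avgLeft h0.abs
  rw [integral_torus' hgc.abs, integral_torus' h0.abs]
  have c1 : Continuous fun y => ∫ x in (0 : ℝ)..1, |g (pt x y)| :=
    intervalIntegral.continuous_parametric_intervalIntegral_of_continuous' (by fun_prop) _ _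
  have c2 : Continuous fun y => ∫ x in (0 : ℝ)..1, |pd 0 g (pt x y)| :=
    intervalIntegral.continuous_parametric_intervalIntegral_of_continuous' (by fun_prop) _ _
  rw [← intervalIntegral.integral_add (c1.intervalIntegrable _ _) (c2.intervalIntegrable _ _)]
  refine intervalIntegral.integral_mono_on zero_le_one
    (Continuous.intervalIntegrable (by fun_prop) _ _) ((c1.add c2).intervalIntegrable _ _)
    fun y _ => (le_abs_self _).trans ?_
  exact abs_le_integral_add (fun x => hasDerivAt_pt_left hd x y) (by fun_prop) hs

lemma abs_integral_left_edge_sub_le {f : Plane → ℝ} (hf : ContDiff ℝ 1 f) :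
    |(∫ θ in (0 : ℝ)..1, f (pt 0 θ)) - ∫ x, f x ∂torus| ≤ ∫ x, |pd 0 f x| ∂torus := by
  have hd : Differentiable ℝ f := hf.differentiable (by simp)
  have hfc := hf.continuous
  have h0 := continuous_pd hf 0
  have c1 : Continuous fun y => ∫ x in (0 : ℝ)..1, f (pt x y) :=
    intervalIntegral.continuous_parametric_intervalIntegral_of_continuous' (by fun_prop) _ _
  have c2 : Continuous fun y => ∫ x in (0 : ℝ)..1, |pd 0 f (pt x y)| :=
    intervalIntegral.continuous_parametric_intervalIntegral_of_continuous' (by fun_prop) _ _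
  rw [integral_torus' hfc, integral_torus' h0.abs,
    ← intervalIntegral.integral_sub (Continuous.intervalIntegrable (by fun_prop) _ _)
      (c1.intervalIntegrable _ _)]
  refine (intervalIntegral.abs_integral_le_integral_abs zero_le_one).trans ?_
  refine intervalIntegral.integral_mono_on zero_le_one
    (Continuous.intervalIntegrable (by fun_prop) _ _) (c2.intervalIntegrable _ _) fun y _ => ?_
  refine abs_sub_integral_le (by fun_prop) fun s hs => ?_
  exact abs_sub_le_integral_abs_deriv (fun x => hasDerivAt_pt_left hd x y) (by fun_prop)
    (by simp) hs

lemma integral_abs_pd_gradient_sq_le {f : Plane → ℝ} (hf : ContDiff ℝ 2 f) :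
    ∫ x, |pd 0 (fun y => pd 0 f y ^ 2 + pd 1 f y ^ 2) x| ∂torus
      ≤ 2 * √(gradSq f * hessSq f) := by
  have h : ∀ k, ContDiff ℝ 1 (pd k f) := contDiff_pd hf (by norm_num)
  have hc : ∀ k, Continuous (pd k f) := fun k => (h k).continuous
  have hcc : ∀ j k, Continuous (pd j (pd k f)) := fun j k => continuous_pd (h k) j
  have hd : ∀ k, Differentiable ℝ (pd k f) := fun k => (h k).differentiable (by simp)
  set g := fun x => pd 0 f x ^ 2 + pd 1 f x ^ 2 with hg
  set q := fun x => pd 0 (pd 0 f) x ^ 2 + pd 1 (pd 0 f) x ^ 2 + pd 0 (pd 1 f) x ^ 2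
    + pd 1 (pd 1 f) x ^ 2 with hq
  have hgc : Continuous g := by fun_prop
  have hqc : Continuous q := by fun_prop
  have hpd : ∀ x, pd 0 g x = 2 * pd 0 f x * pd 0 (pd 0 f) x + 2 * pd 1 f x * pd 0 (pd 1 f) x := by
    intro x
    simp (disch := fun_prop) only [hg, pd_add, pd_pow]
    norm_num
  have hb : ∀ x, |pd 0 g x| ≤ 2 * |√(g x) * √(q x)| := by
    intro x
    rw [← Real.sqrt_mul (by simp only [hg]; positivity), abs_of_nonneg (Real.sqrt_nonneg _),
      show (2 : ℝ) = √(2 ^ 2) by rw [Real.sqrt_sq (by norm_num)], ← Real.sqrt_mul (by norm_num)]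
    refine Real.abs_le_sqrt ?_
    rw [hpd]
    simp only [hg, hq]
    -- Cauchy–Schwarz between ∇f and ∂₀∇f in the form of Lagrange's identity; the second hint
    -- accounts for the unused entries ∂₁∇f of the Hessian.
    nlinarith [sq_nonneg (pd 0 f x * pd 0 (pd 1 f) x - pd 1 f x * pd 0 (pd 0 f) x),
      mul_nonneg (add_nonneg (sq_nonneg (pd 0 f x)) (sq_nonneg (pd 1 f x)))
        (add_nonneg (sq_nonneg (pd 1 (pd 0 f) x)) (sq_nonneg (pd 1 (pd 1 f) x)))]
  have hc1 : Continuous (pd 0 g) := continuous_pd (by fun_prop) 0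
  calc ∫ x, |pd 0 g x| ∂torus ≤ ∫ x, 2 * |√(g x) * √(q x)| ∂torus :=
        integral_mono (integrable_torus (by fun_prop)) (integrable_torus (by fun_prop)) hb
    _ ≤ 2 * √(gradSq f * hessSq f) := by
        rw [integral_const_mul]
        gcongr
        refine (integral_abs_mul_le_sqrt (by fun_prop) (by fun_prop)).trans (le_of_eq ?_)
        congr 2
        · refine integral_congr_ae (Filter.Eventually.of_forall fun x => ?_)
          exact Real.sq_sqrt (by simp only [hg]; positivity)
        · refine integral_congr_ae (Filter.Eventually.of_forall fun x => ?_)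
          exact Real.sq_sqrt (by simp only [hq]; positivity)

/-- The hypothesis says k ≤ √m s^(-1/2), which is integrable at 0. -/
lemma integral_near_le {k : ℝ → ℝ} (hk : Continuous k) {δ m : ℝ} (hδ : 0 < δ)
    (h : ∀ s ∈ Set.Ioo 0 δ, s * k s ^ 2 ≤ m) :
    ∫ s in (0 : ℝ)..δ, k s ≤ 2 * √(δ * m) := by
  have hm : 0 ≤ m := by
    have := h (δ / 2) ⟨by linarith, by linarith⟩
    exact le_trans (by positivity) this
  have e1 : ∫ s in (0 : ℝ)..δ, k s ≤ ∫ s in (0 : ℝ)..δ, √m * s ^ (-(1 / 2) : ℝ) := by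
    refine intervalIntegral.integral_mono_on_of_le_Ioo hδ.le (hk.intervalIntegrable _ _)
      ((intervalIntegral.intervalIntegrable_rpow' (by norm_num)).const_mul _) fun s hs => ?_
    rw [Real.rpow_neg hs.1.le, ← Real.sqrt_eq_rpow, ← div_eq_mul_inv,
      le_div_iff₀ (Real.sqrt_pos.2 hs.1)]
    refine Real.le_sqrt_of_sq_le ?_
    rw [mul_pow, Real.sq_sqrt hs.1.le, mul_comm]
    exact h s hs
  refine e1.trans (le_of_eq ?_)
  rw [intervalIntegral.integral_const_mul, integral_rpow (Or.inl (by norm_num)),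
    Real.sqrt_mul hδ.le]
  norm_num
  rw [← Real.sqrt_eq_rpow]
  ring

/-- Split k = s^(-1/2) · s^(1/2) k in Cauchy–Schwarz. The weight 1/s, integrated from δ to 1, is the
source of the logarithm. -/
lemma sq_integral_far_le {k : ℝ → ℝ} (hk : Continuous k) {δ : ℝ} (hδ : 0 < δ) (hδ1 : δ ≤ 1) :
    (∫ s in δ..1, k s) ^ 2 ≤ Real.log (1 / δ) * ∫ s in δ..1, s * k s ^ 2 := by
  have hpos : ∀ s ∈ Set.Icc δ 1, 0 < s := fun s hs => hδ.trans_le hs.1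
  have h := sq_intervalIntegral_mul_le (f := fun s => (√s)⁻¹) (g := fun s => √s * k s) hδ1
    (Real.continuous_sqrt.continuousOn.inv₀ fun s hs => (Real.sqrt_pos.2 (hpos s hs)).ne')
    (by fun_prop)
  have hu : Set.uIcc δ 1 = Set.Icc δ 1 := Set.uIcc_of_le hδ1
  have e1 : ∫ s in δ..1, (√s)⁻¹ * (√s * k s) = ∫ s in δ..1, k s :=
    intervalIntegral.integral_congr fun s hs => by
      rw [hu] at hs
      have := (Real.sqrt_pos.2 (hpos s hs)).ne'
      field_simp
  have e2 : ∫ s in δ..1, (√s)⁻¹ ^ 2 = Real.log (1 / δ) := by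
    rw [← integral_one_div_of_pos hδ one_pos]
    refine intervalIntegral.integral_congr fun s hs => ?_
    rw [hu] at hs
    simp [Real.sq_sqrt (hpos s hs).le]
  have e3 : ∫ s in δ..1, (√s * k s) ^ 2 = ∫ s in δ..1, s * k s ^ 2 := by
    refine intervalIntegral.integral_congr fun s hs => ?_
    rw [hu] at hs
    simp [mul_pow, Real.sq_sqrt (hpos s hs).le]
  rwa [e1, e2, e3] at h

/-- The triangle is cut at abscissa δ. Beyond δ, the integral of s k² costs only the gradient, times
a logarithm. Before δ, the trace estimate bounds s k² uniformly at the price of the Hessian, but the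
short interval supplies the factor δ. By periodicity the edge of abscissa 1 is the edge of abscissa
0, whose mean is compared with the full mean. -/
lemma sq_sub_mean_origin_le {f : Plane → ℝ} (hf : ContDiff ℝ 2 f) (hp : IsPeriodic f)
    {δ : ℝ} (hδ : 0 < δ) (hδ1 : δ ≤ 1) :
    (f (pt 0 0) - ∫ x, f x ∂torus) ^ 2
      ≤ 8 * gradSq f * Real.log (1 / δ) + 34 * gradSq f
        + 64 * δ * √(gradSq f * hessSq f) := by
  have hf1 : ContDiff ℝ 1 f := hf.of_le (by norm_num)
  have h : ∀ k, ContDiff ℝ 1 (pd k f) := contDiff_pd hf (by norm_num)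
  have hc : ∀ k, Continuous (pd k f) := fun k => (h k).continuous
  have h0 := hc 0
  have h1 := hc 1
  have hfc := hf.continuous
  set g := fun x => pd 0 f x ^ 2 + pd 1 f x ^ 2 with hg
  have hg1 : ContDiff ℝ 1 g := ((h 0).pow 2).add ((h 1).pow 2)
  have hgc := hg1.continuous
  set G := fun x => |pd 0 f x| + |pd 1 f x| with hG
  have hGc : Continuous G := by fun_prop
  have hGg : ∀ x, G x ^ 2 ≤ 2 * g x := fun x => by
    simp only [hG, hg]
    nlinarith [sq_nonneg (|pd 0 f x| - |pd 1 f x|), sq_abs (pd 0 f x), sq_abs (pd 1 f x)]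
  set k := coneMean G with hk
  have hkc : Continuous k := continuous_coneMean hGc
  set X := gradSq f
  set R := √(X * hessSq f)
  have hX : 0 ≤ X := gradSq_nonneg f
  have hvert : ∀ s ∈ Set.Ioc (0 : ℝ) 1, s * k s ^ 2 ≤ 2 * ∫ y in (0 : ℝ)..1, g (pt s y) := by
    intro s hs
    have := mul_sq_coneMean_le (g := fun x => 2 * g x) hGc (by fun_prop) hGg hs
    rwa [intervalIntegral.integral_const_mul] at this
  have hunif : ∀ s ∈ Set.Ioc (0 : ℝ) 1, s * k s ^ 2 ≤ 2 * (X + 2 * R) := by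
    intro s hs
    refine (hvert s hs).trans ?_
    have e1 := integral_vertical_le hg1 (Set.Ioc_subset_Icc_self hs)
    have e2 := integral_abs_pd_gradient_sq_le hf
    have e3 : ∫ x, |g x| ∂torus = X := by
      refine integral_congr_ae (Filter.Eventually.of_forall fun x => ?_)
      exact abs_of_nonneg (by simp only [hg]; positivity)
    linarith
  have hnear := integral_near_le hkc hδ fun s hs => hunif s ⟨hs.1, hs.2.le.trans hδ1⟩
  have hfar := sq_integral_far_le hkc hδ hδ1
  have hlog : 0 ≤ Real.log (1 / δ) := Real.log_nonneg (by rw [le_div_iff₀ hδ]; linarith)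
  have hfar2 : ∫ s in δ..1, s * k s ^ 2 ≤ 2 * X := by
    have c1 : Continuous fun s => ∫ y in (0 : ℝ)..1, g (pt s y) :=
      intervalIntegral.continuous_parametric_intervalIntegral_of_continuous' (by fun_prop) _ _
    have e1 : ∫ s in δ..1, s * k s ^ 2 ≤ ∫ s in δ..1, 2 * ∫ y in (0 : ℝ)..1, g (pt s y) :=
      intervalIntegral.integral_mono_on hδ1 (Continuous.intervalIntegrable (by fun_prop) _ _)
        (Continuous.intervalIntegrable (by fun_prop) _ _)
        fun s hs => hvert s ⟨hδ.trans_le hs.1, hs.2⟩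
    refine e1.trans ?_
    rw [intervalIntegral.integral_const_mul]
    have e2 : X = ∫ s in (0 : ℝ)..1, ∫ y in (0 : ℝ)..1, g (pt s y) := integral_torus hgc
    rw [e2]
    gcongr
    refine intervalIntegral.integral_mono_interval hδ.le hδ1 le_rfl
      (Filter.Eventually.of_forall fun s => ?_) (c1.intervalIntegrable _ _)
    exact intervalIntegral.integral_nonneg zero_le_one fun y _ => by
      simp only [hg]; positivity
  have hcone := abs_sub_integral_cone_le hf1
  have hedge : ∫ θ in (0 : ℝ)..1, f (pt 1 θ) = ∫ θ in (0 : ℝ)..1, f (pt 0 θ) := by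
    refine intervalIntegral.integral_congr fun θ _ => ?_
    have := hp 0 (pt 0 θ)
    rwa [pt_add_e_zero, zero_add] at this
  have hmean := abs_integral_left_edge_sub_le hf1
  have hmean2 : (∫ x, |pd 0 f x| ∂torus) ^ 2 ≤ X := by
    refine (sq_integral_le_torus h0.abs).trans ?_
    simp only [sq_abs]
    exact integral_sq_pd_le_gradSq hf1 0
  rw [hedge, ← intervalIntegral.integral_add_adjacent_intervals (hkc.intervalIntegrable 0 δ)
    (hkc.intervalIntegrable δ 1)] at hcone
  have hR : 0 ≤ R := Real.sqrt_nonneg _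
  have hk0 : ∀ s, 0 ≤ k s := coneMean_nonneg fun x => by simp only [hG]; positivity
  have hn0 : 0 ≤ ∫ s in (0 : ℝ)..δ, k s := intervalIntegral.integral_nonneg hδ.le fun s _ => hk0 s
  have hf0 : 0 ≤ ∫ s in δ..1, k s := intervalIntegral.integral_nonneg hδ1 fun s _ => hk0 s
  have hnear2 : (∫ s in (0 : ℝ)..δ, k s) ^ 2 ≤ 8 * δ * (X + 2 * R) := by
    calc _ ≤ (2 * √(δ * (2 * (X + 2 * R)))) ^ 2 := by gcongr
      _ = _ := by rw [mul_pow, Real.sq_sqrt (by positivity)]; ring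
  have hfar3 : (∫ s in δ..1, k s) ^ 2 ≤ Real.log (1 / δ) * (2 * X) :=
    hfar.trans (mul_le_mul_of_nonneg_left hfar2 hlog)
  generalize (∫ s in (0 : ℝ)..δ, k s) = n at *
  generalize (∫ s in δ..1, k s) = r at *
  generalize (∫ θ in (0 : ℝ)..1, f (pt 0 θ)) = c at *
  generalize (∫ x, |pd 0 f x| ∂torus) = b at *
  generalize (∫ x, f x ∂torus) = m at *
  have hb : (c - m) ^ 2 ≤ b ^ 2 := sq_le_sq.2 (hmean.trans (le_abs_self _))
  have ha : (f (pt 0 0) - c) ^ 2 ≤ (n + r) ^ 2 := sq_le_sq.2 (hcone.trans (le_abs_self _))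
  have hs : (f (pt 0 0) - m) ^ 2 ≤ 2 * (f (pt 0 0) - c) ^ 2 + 2 * (c - m) ^ 2 := by
    nlinarith [sq_nonneg (f (pt 0 0) - c - (c - m))]
  have hs2 : (n + r) ^ 2 ≤ 2 * n ^ 2 + 2 * r ^ 2 := by nlinarith [sq_nonneg (n - r)]
  -- The total is 4n² + 4r² + 2b² ≤ 32δX + 64δR + 8X log(1/δ) + 2X; since δ ≤ 1, the two plain
  -- multiples of X merge into 34X.
  nlinarith [mul_nonneg (sub_nonneg.2 hδ1) hX]

/-- Bound of the supremum by the gradient, up to a logarithm, and the Hessian. -/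
lemma sq_sub_mean_le {f : Plane → ℝ} (hf : ContDiff ℝ 2 f) (hp : IsPeriodic f)
    {δ : ℝ} (hδ : 0 < δ) (hδ1 : δ ≤ 1) (a : Plane) :
    (f a - ∫ x, f x ∂torus) ^ 2
      ≤ 8 * gradSq f * Real.log (1 / δ) + 34 * gradSq f
        + 64 * δ * √(gradSq f * hessSq f) := by
  have hpd : ∀ (F : Plane → ℝ) k, pd k (fun x => F (a + x)) = fun x => pd k F (a + x) := by
    intro F k
    funext x
    simp only [pd, fderiv_comp_add_left]
  have h : ∀ k, ContDiff ℝ 1 (pd k f) := contDiff_pd hf (by norm_num)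
  have hc : ∀ k, Continuous (pd k f) := fun k => (h k).continuous
  have hcc : ∀ j k, Continuous (pd j (pd k f)) := fun j k => continuous_pd (h k) j
  have hper : ∀ k, IsPeriodic (pd k f) := isPeriodic_pd hp
  have hper2 : ∀ j k, IsPeriodic (pd j (pd k f)) := fun j k => isPeriodic_pd (hper k) j
  have e1 : gradSq (fun x => f (a + x)) = gradSq f := by
    unfold gradSq
    simp only [hpd]
    refine integral_torus_translate (f := fun x => pd 0 f x ^ 2 + pd 1 f x ^ 2) (by fun_prop)
      (fun k x => ?_) a
    simp only [hper _ k x]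
  have e2 : hessSq (fun x => f (a + x)) = hessSq f := by
    unfold hessSq
    simp only [hpd]
    refine integral_torus_translate (f := fun x => pd 0 (pd 0 f) x ^ 2 + pd 1 (pd 0 f) x ^ 2
      + pd 0 (pd 1 f) x ^ 2 + pd 1 (pd 1 f) x ^ 2) (by fun_prop) (fun k x => ?_) a
    simp only [hper2 _ _ k x]
  have := sq_sub_mean_origin_le (f := fun x => f (a + x)) (by fun_prop)
    (fun k x => by simp only [← add_assoc, hp k]) hδ hδ1
  rw [e1, e2, integral_torus_translate hf.continuous hp] at this
  have h00 : a + pt 0 0 = a := by simp [pt_eq]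
  rwa [h00] at this

/-! ### Functions of time and space -/

/-- Joint smoothness in time and space on a set of times. -/
def SmoothOn (I : Set ℝ) (G : ℝ → Plane → ℝ) : Prop :=
  ContDiffOn ℝ ∞ (fun z : ℝ × Plane => G z.1 z.2) (I ×ˢ Set.univ)

namespace SmoothOn

variable {I J : Set ℝ} {G K : ℝ → Plane → ℝ}

lemma mono (h : SmoothOn I G) (hJ : J ⊆ I) : SmoothOn J G :=
  ContDiffOn.mono h (Set.prod_mono hJ subset_rfl)

lemma add (h : SmoothOn I G) (h' : SmoothOn I K) : SmoothOn I fun t x => G t x + K t x :=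
  ContDiffOn.add h h'

lemma sub (h : SmoothOn I G) (h' : SmoothOn I K) : SmoothOn I fun t x => G t x - K t x :=
  ContDiffOn.sub h h'

lemma mul (h : SmoothOn I G) (h' : SmoothOn I K) : SmoothOn I fun t x => G t x * K t x :=
  ContDiffOn.mul h h'

lemma pow (h : SmoothOn I G) (n : ℕ) : SmoothOn I fun t x => G t x ^ n :=
  ContDiffOn.pow h n

lemma slice (h : SmoothOn I G) {t : ℝ} (ht : t ∈ I) : ContDiff ℝ ∞ (G t) := by
  have h2 : ContDiff ℝ ∞ fun x : Plane => (t, x) := by fun_prop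
  have := ContDiffOn.comp_contDiff (s := I ×ˢ Set.univ) h h2 fun x => ⟨ht, trivial⟩
  exact this

lemma congr (h : SmoothOn I G) (hK : ∀ t ∈ I, ∀ x, K t x = G t x) : SmoothOn I K :=
  ContDiffOn.congr h fun z hz => hK z.1 hz.1 z.2

/-- `I` is not assumed open, so that the initial time may be included. A spatial derivative is the
derivative within `I ×ˢ univ` in a direction tangent to the time slice, hence two-sided even at an
end point of `I`. -/
lemma pd (h : SmoothOn I G) (hI : UniqueDiffOn ℝ I) (k : Fin 2) :
    SmoothOn I fun t => pd k (G t) := by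
  have hu : UniqueDiffOn ℝ (I ×ˢ (Set.univ : Set Plane)) := hI.prod uniqueDiffOn_univ
  have h1 := (ContDiffOn.fderivWithin h hu (m := ∞) (by norm_num)).clm_apply
    (contDiffOn_const (c := ((0 : ℝ), e k)))
  refine ContDiffOn.congr h1 fun z hz => ?_
  have h2 := (ContDiffOn.differentiableOn h (by simp) z hz).hasFDerivWithinAt
  have h3 : HasFDerivAt (fun x : Plane => (z.1, x)) (ContinuousLinearMap.inr ℝ ℝ Plane) z.2 :=
    hasFDerivAt_prodMk_right z.1 z.2
  have h4 := h2.comp_hasFDerivAt (f := fun x : Plane => (z.1, x)) z.2 h3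
    (Filter.Eventually.of_forall fun x => ⟨hz.1, trivial⟩)
  change fderiv ℝ (G z.1) z.2 (e k) = _
  rw [show fderiv ℝ (G z.1) z.2 = _ from h4.fderiv]
  simp

lemma contDiffAt (h : SmoothOn I G) (hI : IsOpen I) {t : ℝ} (ht : t ∈ I) (x : Plane) :
    ContDiffAt ℝ ∞ (fun z : ℝ × Plane => G z.1 z.2) (t, x) :=
  ContDiffOn.contDiffAt h ((hI.prod isOpen_univ).mem_nhds ⟨ht, trivial⟩)

lemma hasDerivAt_fderiv (h : SmoothOn I G) (hI : IsOpen I) {t : ℝ} (ht : t ∈ I) (x : Plane) :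
    HasDerivAt (fun s => G s x) (fderiv ℝ (fun z : ℝ × Plane => G z.1 z.2) (t, x) (1, 0)) t := by
  have h1 := ((h.contDiffAt hI ht x).differentiableAt (by simp)).hasFDerivAt
  have h2 : HasDerivAt (fun s : ℝ => (s, x)) ((1 : ℝ), (0 : Plane)) t :=
    (hasDerivAt_id t).prodMk (hasDerivAt_const t x)
  exact h1.comp_hasDerivAt (f := fun s : ℝ => (s, x)) t h2

lemma hasDerivAt (h : SmoothOn I G) (hI : IsOpen I) {t : ℝ} (ht : t ∈ I) (x : Plane) :
    HasDerivAt (fun s => G s x) (INS.dt G t x) t :=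
  (h.hasDerivAt_fderiv hI ht x).differentiableAt.hasDerivAt

lemma dt_eq (h : SmoothOn I G) (hI : IsOpen I) {t : ℝ} (ht : t ∈ I) (x : Plane) :
    INS.dt G t x = fderiv ℝ (fun z : ℝ × Plane => G z.1 z.2) (t, x) (1, 0) :=
  (h.hasDerivAt_fderiv hI ht x).deriv

lemma pd_eq (h : SmoothOn I G) (hI : IsOpen I) {t : ℝ} (ht : t ∈ I) (k : Fin 2) (x : Plane) :
    INS.pd k (G t) x = fderiv ℝ (fun z : ℝ × Plane => G z.1 z.2) (t, x) (0, e k) := by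
  have h1 := ((h.contDiffAt hI ht x).differentiableAt (by simp)).hasFDerivAt
  have h2 := h1.comp (f := fun x : Plane => (t, x)) x (hasFDerivAt_prodMk_right t x)
  change fderiv ℝ (G t) x (e k) = _
  rw [show fderiv ℝ (G t) x = _ from h2.fderiv]
  simp

lemma dt (h : SmoothOn I G) (hI : IsOpen I) : SmoothOn I (dt G) := by
  have h1 := (ContDiffOn.fderiv_of_isOpen h (hI.prod isOpen_univ) (m := ∞) (by norm_num)).clm_apply
    (contDiffOn_const (c := ((1 : ℝ), (0 : Plane))))
  exact ContDiffOn.congr h1 fun z hz => h.dt_eq hI hz.1 z.2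

/-- Time and space derivatives commute. -/
lemma dt_pd (h : SmoothOn I G) (hI : IsOpen I) {t : ℝ} (ht : t ∈ I) (k : Fin 2) (x : Plane) :
    INS.dt (fun s => INS.pd k (G s)) t x = INS.pd k (INS.dt G t) x := by
  set F := fun z : ℝ × Plane => G z.1 z.2
  have hF := h.contDiffAt hI ht x
  have hs : IsSymmSndFDerivAt ℝ F (t, x) := hF.isSymmSndFDerivAt (by
    simpa using WithTop.coe_le_coe.2 (le_top (a := (2 : ℕ∞))))
  have hd : HasFDerivAt (fderiv ℝ F) (fderiv ℝ (fderiv ℝ F) (t, x)) (t, x) :=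
    ((hF.fderiv_right (m := 1) (WithTop.coe_le_coe.2 le_top)).differentiableAt
      (by simp)).hasFDerivAt
  have e1 : INS.dt (fun s => INS.pd k (G s)) t x
      = fderiv ℝ (fderiv ℝ F) (t, x) (1, 0) (0, e k) := by
    have h2 : HasDerivAt (fun s : ℝ => (s, x)) ((1 : ℝ), (0 : Plane)) t :=
      (hasDerivAt_id t).prodMk (hasDerivAt_const t x)
    have h3 := (hd.comp_hasDerivAt (f := fun s : ℝ => (s, x)) t h2).clm_apply
      (hasDerivAt_const t ((0 : ℝ), e k))
    have h4 : (fun s => INS.pd k (G s) x) =ᶠ[nhds t] fun s => fderiv ℝ F (s, x) (0, e k) :=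
      (hI.eventually_mem ht).mono fun s hs => h.pd_eq hI hs k x
    have h5 := (h3.congr_of_eventuallyEq h4).deriv
    simpa [INS.dt] using h5
  have e2 : INS.pd k (INS.dt G t) x = fderiv ℝ (fderiv ℝ F) (t, x) (0, e k) (1, 0) := by
    have h3 := (hd.comp (f := fun x : Plane => (t, x)) x (hasFDerivAt_prodMk_right t x)).clm_apply
      (hasFDerivAt_const ((1 : ℝ), (0 : Plane)) x)
    have h4 : INS.dt G t = fun y => fderiv ℝ F (t, y) (1, 0) :=
      funext fun y => h.dt_eq hI ht y
    rw [h4]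
    change fderiv ℝ (fun y => fderiv ℝ F (t, y) (1, 0)) x (e k) = _
    rw [show fderiv ℝ (fun y => fderiv ℝ F (t, y) (1, 0)) x = _ from h3.fderiv]
    simp
  rw [e1, e2, hs.eq]

lemma exists_bound (h : SmoothOn I G) {S : Set ℝ} (hS : IsCompact S) (hSI : S ⊆ I) :
    ∃ C, ∀ t ∈ S, ∀ x ∈ closedCell, ‖G t x‖ ≤ C := by
  obtain ⟨C, hC⟩ := (hS.prod isCompact_closedCell).exists_bound_of_continuousOn
    ((ContDiffOn.continuousOn h).mono (Set.prod_mono hSI (Set.subset_univ _)))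
  exact ⟨C, fun t ht x hx => hC (t, x) ⟨ht, hx⟩⟩

/-- Differentiation of a spatial integral with respect to time. -/
lemma hasDerivAt_integral (h : SmoothOn I G) (hI : IsOpen I) {t : ℝ} (ht : t ∈ I) :
    HasDerivAt (fun s => ∫ x, G s x ∂torus) (∫ x, INS.dt G t x ∂torus) t := by
  obtain ⟨ε, hε, hball⟩ := Metric.nhds_basis_closedBall.mem_iff.1 (hI.mem_nhds ht)
  obtain ⟨C, hC⟩ := (h.dt hI).exists_bound (isCompact_closedBall t ε) hball
  have hc : ∀ s ∈ I, Continuous (G s) := fun s hs => (h.slice hs).continuous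
  refine (hasDerivAt_integral_of_dominated_loc_of_deriv_le (bound := fun _ => C)
    (Metric.closedBall_mem_nhds t hε)
    ((hI.eventually_mem ht).mono fun s hs => (hc s hs).aestronglyMeasurable)
    (integrable_torus (hc t ht))
    (((h.dt hI).slice ht).continuous.aestronglyMeasurable) ?_ (integrable_const _) ?_).2
  · exact ae_mem_closedCell.mono fun x hx s hs => hC s hs x hx
  · exact Filter.Eventually.of_forall fun x s hs => h.hasDerivAt hI (hball hs) x

lemma continuousOn_integral {T : ℝ} (h : SmoothOn (Set.Ico 0 T) G) :
    ContinuousOn (fun s => ∫ x, G s x ∂torus) (Set.Ico 0 T) := by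
  intro t ht
  obtain ⟨b, htb, hbT⟩ := exists_between ht.2
  obtain ⟨C, hC⟩ := h.exists_bound (isCompact_Icc (a := 0) (b := b))
    fun s hs => ⟨hs.1, hs.2.trans_lt hbT⟩
  refine continuousWithinAt_of_dominated (bound := fun _ => C) ?_ ?_ (integrable_const _) ?_
  · exact eventually_mem_nhdsWithin.mono fun s hs => (h.slice hs).continuous.aestronglyMeasurable
  · filter_upwards [eventually_mem_nhdsWithin,
      mem_nhdsWithin_of_mem_nhds (Iio_mem_nhds htb)] with s hs hsb
    exact ae_mem_closedCell.mono fun x hx => hC s ⟨hs.1, le_of_lt hsb⟩ x hx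
  · refine Filter.Eventually.of_forall fun x => ?_
    have h1 : ContinuousOn (fun z : ℝ × Plane => G z.1 z.2) (Set.Ico 0 T ×ˢ Set.univ) :=
      ContDiffOn.continuousOn h
    exact (h1.comp (f := fun s : ℝ => (s, x)) (s := Set.Ico 0 T) (by fun_prop)
      fun s hs => ⟨hs, trivial⟩) t ht

end SmoothOn

/-! ### Integral identities on the torus -/

lemma one_le : (1 : WithTop ℕ∞) ≤ (⊤ : ℕ∞) := WithTop.coe_le_coe.2 le_top

lemma two_le : (2 : WithTop ℕ∞) ≤ (⊤ : ℕ∞) := WithTop.coe_le_coe.2 le_top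

lemma smooth_pd {f : Plane → ℝ} (hf : ContDiff ℝ ∞ f) (k : Fin 2) : ContDiff ℝ ∞ (pd k f) :=
  contDiff_pd hf (by norm_num) k

lemma IsPeriodic.mul {f g : Plane → ℝ} (hf : IsPeriodic f) (hg : IsPeriodic g) :
    IsPeriodic fun x => f x * g x := fun k x => by simp only [hf k x, hg k x]

lemma IsPeriodic.add {f g : Plane → ℝ} (hf : IsPeriodic f) (hg : IsPeriodic g) :
    IsPeriodic fun x => f x + g x := fun k x => by simp only [hf k x, hg k x]

lemma lap_eq (f : Plane → ℝ) (x : Plane) : lap f x = pd 0 (pd 0 f) x + pd 1 (pd 1 f) x := by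
  simp [lap]

lemma contDiff_lap {f : Plane → ℝ} (hf : ContDiff ℝ ∞ f) : ContDiff ℝ ∞ (lap f) := by
  have h : ∀ k, ContDiff ℝ ∞ (pd k (pd k f)) := fun k => smooth_pd (smooth_pd hf k) k
  have : lap f = fun x => pd 0 (pd 0 f) x + pd 1 (pd 1 f) x := funext (lap_eq f)
  rw [this]
  exact (h 0).add (h 1)

lemma isPeriodic_lap {f : Plane → ℝ} (hf : IsPeriodic f) : IsPeriodic (lap f) := fun k x => by
  simp only [lap_eq, isPeriodic_pd (isPeriodic_pd hf _) _ k x]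

lemma pd_lap {f : Plane → ℝ} (hf : ContDiff ℝ ∞ f) (k : Fin 2) :
    pd k (lap f) = lap (pd k f) := by
  have h : ∀ k, ContDiff ℝ ∞ (pd k f) := smooth_pd hf
  have h2 : ∀ j k, ContDiff ℝ ∞ (pd j (pd k f)) := fun j k => smooth_pd (h k) j
  funext x
  have : lap f = fun x => pd 0 (pd 0 f) x + pd 1 (pd 1 f) x := funext (lap_eq f)
  rw [this, pd_add ((h2 0 0).differentiable (by simp) x) ((h2 1 1).differentiable (by simp) x),
    lap_eq, pd_comm ((h 0).of_le two_le), pd_comm ((h 1).of_le two_le), pd_comm (hf.of_le two_le) k 0,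
    pd_comm (hf.of_le two_le) k 1]

/-- Advection by a divergence free field has mean zero. -/
lemma integral_advection {u : Fin 2 → Plane → ℝ} {q : Plane → ℝ} (hu : ∀ i, ContDiff ℝ 1 (u i))
    (hup : ∀ i, IsPeriodic (u i)) (hdiv : ∀ x, pd 0 (u 0) x + pd 1 (u 1) x = 0)
    (hq : ContDiff ℝ 1 q) (hqp : IsPeriodic q) :
    ∫ x, u 0 x * pd 0 q x + u 1 x * pd 1 q x ∂torus = 0 := by
  have h := fun k => integral_pd ((hu k).mul hq) ((hup k).mul hqp) k
  have hc := fun k => continuous_pd ((hu k).mul hq) k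
  have h2 := integral_add (integrable_torus (hc 0)) (integrable_torus (hc 1))
  rw [h, h, add_zero] at h2
  rw [← h2]
  congr 1
  funext x
  have hud := fun i => (hu i).differentiable (by simp)
  have hqd := hq.differentiable (by simp)
  rw [pd_mul (hud 0 x) (hqd x), pd_mul (hud 1 x) (hqd x)]
  linear_combination (-q x) * hdiv x

lemma integral_mul_lap {f g : Plane → ℝ} (hf : ContDiff ℝ 1 f) (hfp : IsPeriodic f)
    (hg : ContDiff ℝ 2 g) (hgp : IsPeriodic g) :
    ∫ x, f x * lap g x ∂torus = -∫ x, pd 0 f x * pd 0 g x + pd 1 f x * pd 1 g x ∂torus := by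
  have hg1 : ∀ k, ContDiff ℝ 1 (pd k g) := contDiff_pd hg (by norm_num)
  have h := fun k => integral_pd (hf.mul (hg1 k)) (hfp.mul (isPeriodic_pd hgp k)) k
  have hc := fun k => continuous_pd (hf.mul (hg1 k)) k
  have hcf := continuous_pd hf
  have hcg := fun k => (hg1 k).continuous
  have hcl : Continuous fun x => f x * lap g x := by
    have := hf.continuous
    have := fun k => continuous_pd (hg1 k) k
    simp only [lap_eq]
    fun_prop
  have h2 := integral_add (integrable_torus (hc 0)) (integrable_torus (hc 1))
  rw [h, h, add_zero] at h2
  rw [eq_neg_iff_add_eq_zero, ← integral_add (integrable_torus hcl) (integrable_torus (by fun_prop)),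
    ← h2]
  congr 1
  funext x
  have hfd := hf.differentiable (by simp)
  have hgd := fun k => (hg1 k).differentiable (by simp)
  rw [pd_mul (hfd x) (hgd 0 x), pd_mul (hfd x) (hgd 1 x), lap_eq]
  ring

/-- Integrate by parts twice, commuting the Laplacian with first derivatives in between; periodicity
leaves no boundary terms. -/
lemma integral_sq_lap {g : Plane → ℝ} (hg : ContDiff ℝ ∞ g) (hgp : IsPeriodic g) :
    ∫ x, lap g x ^ 2 ∂torus = hessSq g := by
  have h : ∀ k, ContDiff ℝ ∞ (pd k g) := smooth_pd hg
  have hl := contDiff_lap hg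
  have h2 : ∀ j k, Continuous (pd j (pd k g)) := fun j k => continuous_pd ((h k).of_le one_le) j
  have e1 := integral_mul_lap (hl.of_le one_le) (isPeriodic_lap hgp) (hg.of_le two_le) hgp
  have e2 : ∀ k, ∫ x, pd k g x * lap (pd k g) x ∂torus = - gradSq (pd k g) := fun k => by
    rw [integral_mul_lap ((h k).of_le one_le) (isPeriodic_pd hgp k) ((h k).of_le two_le)
      (isPeriodic_pd hgp k)]
    simp only [gradSq, sq]
  have hlc : ∀ k, Continuous fun x => pd k g x * lap (pd k g) x := fun k =>
    (h k).continuous.mul (contDiff_lap (h k)).continuous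
  simp only [sq]
  rw [e1]
  simp only [pd_lap hg, mul_comm (lap _ _)]
  rw [integral_add (integrable_torus (hlc 0)) (integrable_torus (hlc 1)), e2, e2, gradSq, gradSq,
    ← neg_add, neg_neg, ← integral_add (integrable_torus (by fun_prop))
      (integrable_torus (by fun_prop))]
  simp only [hessSq, add_assoc]

/-! ### Integral identities for the system at a fixed time -/

/-- Fields at a fixed time: density `r` and its time derivative `r'`, components of the velocity
`u` and of its time derivative `a`, pressure `p`. -/
structure Snapshot (r r' : Plane → ℝ) (u a : Fin 2 → Plane → ℝ) (p : Plane → ℝ) : Prop where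
  smooth_r : ContDiff ℝ ∞ r
  smooth_u : ∀ i, ContDiff ℝ ∞ (u i)
  smooth_a : ∀ i, ContDiff ℝ ∞ (a i)
  diff_p : Differentiable ℝ p
  per_r : IsPeriodic r
  per_u : ∀ i, IsPeriodic (u i)
  per_a : ∀ i, IsPeriodic (a i)
  per_p : IsPeriodic p
  div_u : ∀ x, pd 0 (u 0) x + pd 1 (u 1) x = 0
  div_a : ∀ x, pd 0 (a 0) x + pd 1 (a 1) x = 0
  transport : ∀ x, r' x + (u 0 x * pd 0 r x + u 1 x * pd 1 r x) = 0
  momentum : ∀ i x, r x * a i x + r x * (u 0 x * pd 0 (u i) x + u 1 x * pd 1 (u i) x)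
    - lap (u i) x + pd i p x = 0

/-- The convective term `u · ∇ u`. -/
def conv (u : Fin 2 → Plane → ℝ) (i : Fin 2) (x : Plane) : ℝ :=
  u 0 x * pd 0 (u i) x + u 1 x * pd 1 (u i) x

namespace Snapshot

variable {r r' : Plane → ℝ} {u a : Fin 2 → Plane → ℝ} {p : Plane → ℝ}

lemma smooth_pd_u (h : Snapshot r r' u a p) (k i : Fin 2) : ContDiff ℝ ∞ (pd k (u i)) :=
  smooth_pd (h.smooth_u i) k

lemma smooth_conv (h : Snapshot r r' u a p) (i : Fin 2) : ContDiff ℝ ∞ (conv u i) :=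
  ((h.smooth_u 0).mul (h.smooth_pd_u 0 i)).add ((h.smooth_u 1).mul (h.smooth_pd_u 1 i))

lemma pd_p_eq (h : Snapshot r r' u a p) (i : Fin 2) :
    pd i p = fun x => lap (u i) x - r x * (a i x + conv u i x) := by
  funext x
  have := h.momentum i x
  unfold conv
  linear_combination this

lemma smooth_pd_p (h : Snapshot r r' u a p) (i : Fin 2) : ContDiff ℝ ∞ (pd i p) := by
  rw [h.pd_p_eq i]
  exact (contDiff_lap (h.smooth_u i)).sub (h.smooth_r.mul ((h.smooth_a i).add (h.smooth_conv i)))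

/-- The pressure is only assumed differentiable, but the momentum equation expresses its gradient
through smooth fields. -/
lemma contDiff_p (h : Snapshot r r' u a p) : ContDiff ℝ 1 p := by
  refine contDiff_one_iff_fderiv.2 ⟨h.diff_p, ?_⟩
  refine continuous_clm_apply.2 fun y => ?_
  have : (fun x => fderiv ℝ p x y) = fun x => y 0 * pd 0 p x + y 1 * pd 1 p x := by
    funext x
    have hy : y = y 0 • e 0 + y 1 • e 1 := by rw [← pt_eq, pt_eta]
    conv_lhs => rw [hy]
    simp [pd]
  rw [this]
  have := fun i => (h.smooth_pd_p i).continuous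
  fun_prop

lemma integral_advection (h : Snapshot r r' u a p) {q : Plane → ℝ} (hq : ContDiff ℝ 1 q)
    (hqp : IsPeriodic q) : ∫ x, u 0 x * pd 0 q x + u 1 x * pd 1 q x ∂torus = 0 :=
  INS.integral_advection (fun i => (h.smooth_u i).of_le one_le) h.per_u h.div_u hq hqp

lemma integral_transport (h : Snapshot r r' u a p) : ∫ x, r' x ∂torus = 0 := by
  have : r' = fun x => -(u 0 x * pd 0 r x + u 1 x * pd 1 r x) := by
    funext x
    linear_combination h.transport x
  rw [this, integral_neg, h.integral_advection (h.smooth_r.of_le one_le) h.per_r, neg_zero]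

/-- The square of the density is transported as well. -/
lemma integral_transport_sq (h : Snapshot r r' u a p) : ∫ x, 2 * r x * r' x ∂torus = 0 := by
  have hd := h.smooth_r.differentiable (by simp)
  have : (fun x => 2 * r x * r' x) = fun x => -(u 0 x * pd 0 (fun y => r y * r y) x
      + u 1 x * pd 1 (fun y => r y * r y) x) := by
    funext x
    simp (disch := fun_prop) only [pd_mul]
    linear_combination 2 * r x * h.transport x
  rw [this, integral_neg, h.integral_advection ((h.smooth_r.mul h.smooth_r).of_le one_le)
    (h.per_r.mul h.per_r), neg_zero]

lemma integral_lap (h : Snapshot r r' u a p) (i : Fin 2) : ∫ x, lap (u i) x ∂torus = 0 := by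
  have := integral_mul_lap (f := fun _ => (1 : ℝ)) contDiff_const (fun _ _ => rfl)
    ((h.smooth_u i).of_le two_le) (h.per_u i)
  simpa [pd] using this

lemma integral_momentum (h : Snapshot r r' u a p) (i : Fin 2) :
    ∫ x, r' x * u i x + r x * a i x ∂torus = 0 := by
  have hdr := h.smooth_r.differentiable (by simp)
  have hdu := fun i => (h.smooth_u i).differentiable (by simp)
  have hru := (h.smooth_r.mul (h.smooth_u i)).of_le one_le
  have hcl := (contDiff_lap (h.smooth_u i)).continuous
  have hcp := (h.smooth_pd_p i).continuous
  have hcu := fun i => (h.smooth_u i).continuous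
  have hcru := continuous_pd hru
  have : (fun x => r' x * u i x + r x * a i x) = fun x => lap (u i) x - pd i p x
      - (u 0 x * pd 0 (fun y => r y * u i y) x + u 1 x * pd 1 (fun y => r y * u i y) x) := by
    funext x
    simp (disch := fun_prop) only [pd_mul]
    linear_combination u i x * h.transport x + h.momentum i x
  rw [this, integral_sub (by exact integrable_torus (hcl.sub hcp))
      (integrable_torus (by fun_prop)),
    integral_sub (integrable_torus hcl) (integrable_torus hcp), h.integral_lap,
    integral_pd h.contDiff_p h.per_p, h.integral_advection hru (h.per_r.mul (h.per_u i))]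
  simp

/-- The energy identity. -/
lemma integral_energy (h : Snapshot r r' u a p) :
    ∫ x, r' x * (u 0 x ^ 2 + u 1 x ^ 2) + 2 * r x * (u 0 x * a 0 x + u 1 x * a 1 x) ∂torus
      = -2 * (gradSq (u 0) + gradSq (u 1)) := by
  have hdr := h.smooth_r.differentiable (by simp)
  have hdu := fun i => (h.smooth_u i).differentiable (by simp)
  have hcu := fun i => (h.smooth_u i).continuous
  have hcl := fun i => (contDiff_lap (h.smooth_u i)).continuous
  have hcp := fun i => (h.smooth_pd_p i).continuous
  have hsm : ContDiff ℝ 1 fun x => r x * (u 0 x * u 0 x + u 1 x * u 1 x) := by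
    have := h.smooth_r.of_le one_le
    have := fun i => (h.smooth_u i).of_le one_le
    fun_prop
  have hper : IsPeriodic fun x => r x * (u 0 x * u 0 x + u 1 x * u 1 x) :=
    h.per_r.mul (((h.per_u 0).mul (h.per_u 0)).add ((h.per_u 1).mul (h.per_u 1)))
  have hcs := continuous_pd hsm
  have : (fun x => r' x * (u 0 x ^ 2 + u 1 x ^ 2) + 2 * r x * (u 0 x * a 0 x + u 1 x * a 1 x))
      = fun x => (2 * (u 0 x * lap (u 0) x) + 2 * (u 1 x * lap (u 1) x))
      - (2 * (u 0 x * pd 0 p x + u 1 x * pd 1 p x)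
      + (u 0 x * pd 0 (fun y => r y * (u 0 y * u 0 y + u 1 y * u 1 y)) x
        + u 1 x * pd 1 (fun y => r y * (u 0 y * u 0 y + u 1 y * u 1 y)) x)) := by
    funext x
    simp (disch := fun_prop) only [pd_mul, pd_add]
    linear_combination (u 0 x ^ 2 + u 1 x ^ 2) * h.transport x + 2 * u 0 x * h.momentum 0 x
      + 2 * u 1 x * h.momentum 1 x
  have hl : ∀ i, ∫ x, u i x * lap (u i) x ∂torus = - gradSq (u i) := fun i => by
    rw [integral_mul_lap ((h.smooth_u i).of_le one_le) (h.per_u i) ((h.smooth_u i).of_le two_le)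
      (h.per_u i)]
    simp only [gradSq, sq]
  rw [this, integral_sub (integrable_torus (by fun_prop)) (integrable_torus (by fun_prop)),
    integral_add (integrable_torus (by fun_prop)) (integrable_torus (by fun_prop)),
    integral_add (integrable_torus (by fun_prop)) (integrable_torus (by fun_prop)),
    integral_const_mul, integral_const_mul, integral_const_mul, hl, hl,
    h.integral_advection h.contDiff_p h.per_p, h.integral_advection hsm hper]
  ring

/-- The momentum equation tested with the time derivative of the velocity. -/
lemma integral_gradient_energy (h : Snapshot r r' u a p) :
    ∫ x, 2 * (pd 0 (u 0) x * pd 0 (a 0) x + pd 1 (u 0) x * pd 1 (a 0) x)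
        + 2 * (pd 0 (u 1) x * pd 0 (a 1) x + pd 1 (u 1) x * pd 1 (a 1) x) ∂torus
      = ∫ x, -2 * r x * (a 0 x * (a 0 x + conv u 0 x) + a 1 x * (a 1 x + conv u 1 x)) ∂torus := by
  have hcr := h.smooth_r.continuous
  have hcu := fun i => (h.smooth_u i).continuous
  have hca := fun i => (h.smooth_a i).continuous
  have hcc := fun i => (h.smooth_conv i).continuous
  have hcp := fun i => (h.smooth_pd_p i).continuous
  have hcl := fun i => (contDiff_lap (h.smooth_u i)).continuous
  have hcpu := fun k i => (h.smooth_pd_u k i).continuous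
  have hcpa := fun k i => continuous_pd ((h.smooth_a i).of_le one_le) k
  have hl : ∀ i, ∫ x, pd 0 (u i) x * pd 0 (a i) x + pd 1 (u i) x * pd 1 (a i) x ∂torus
      = - ∫ x, a i x * lap (u i) x ∂torus := fun i => by
    rw [integral_mul_lap ((h.smooth_a i).of_le one_le) (h.per_a i) ((h.smooth_u i).of_le two_le)
      (h.per_u i), neg_neg]
    simp only [mul_comm]
  have hp := INS.integral_advection (fun i => (h.smooth_a i).of_le one_le) h.per_a h.div_a
    h.contDiff_p h.per_p
  have : (fun x => -2 * r x * (a 0 x * (a 0 x + conv u 0 x) + a 1 x * (a 1 x + conv u 1 x)))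
      = fun x => (-2 * (a 0 x * lap (u 0) x) + -2 * (a 1 x * lap (u 1) x))
        + 2 * (a 0 x * pd 0 p x + a 1 x * pd 1 p x) := by
    funext x
    rw [h.pd_p_eq 0, h.pd_p_eq 1]
    ring
  rw [this, integral_add (integrable_torus (by fun_prop)) (integrable_torus (by fun_prop)),
    integral_add (integrable_torus (by fun_prop)) (integrable_torus (by fun_prop)),
    integral_add (integrable_torus (by fun_prop)) (integrable_torus (by fun_prop)),
    integral_const_mul, integral_const_mul, integral_const_mul, integral_const_mul,
    integral_const_mul, hl, hl, hp]
  ring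

/-- The identity behind the regularity of the Stokes system. -/
lemma integral_stokes (h : Snapshot r r' u a p) :
    ∫ x, (r x * (a 0 x + conv u 0 x)) ^ 2 + (r x * (a 1 x + conv u 1 x)) ^ 2 ∂torus
      = hessSq (u 0) + hessSq (u 1) + gradSq p := by
  have hcp := fun i => (h.smooth_pd_p i).continuous
  have hcl := fun i => (contDiff_lap (h.smooth_u i)).continuous
  -- Δu is divergence free because Δ commutes with the divergence; hence it is orthogonal to ∇p and
  -- the cross term of |Δu - ∇p|² vanishes.
  have hp := INS.integral_advection (u := fun i => lap (u i))
    (fun i => (contDiff_lap (h.smooth_u i)).of_le one_le) (fun i => isPeriodic_lap (h.per_u i))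
    (fun x => by
      simp only [pd_lap (h.smooth_u _)]
      have hd := fun j k i => (smooth_pd (h.smooth_pd_u k i) j).differentiable (by simp)
      have hd1 := fun k i => (h.smooth_pd_u k i).differentiable (by simp)
      have hz : (fun y => pd 0 (u 0) y + pd 1 (u 1) y) = fun _ => 0 := funext h.div_u
      have h1 : ∀ k, pd k (fun y => pd 0 (u 0) y + pd 1 (u 1) y)
          = fun y => pd k (pd 0 (u 0)) y + pd k (pd 1 (u 1)) y := fun k => funext fun y =>
        pd_add (hd1 0 0 y) (hd1 1 1 y) k
      have h2 : ∀ k, pd k (fun y => pd k (pd 0 (u 0)) y + pd k (pd 1 (u 1)) y) x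
          = pd k (pd k (pd 0 (u 0))) x + pd k (pd k (pd 1 (u 1))) x := fun k =>
        pd_add (hd k 0 0 x) (hd k 1 1 x) k
      have h3 : ∀ k, pd k (fun y => pd k (pd 0 (u 0)) y + pd k (pd 1 (u 1)) y) x = 0 := fun k => by
        have hz0 : pd k (fun _ => (0 : ℝ)) = fun _ => 0 := by
          funext y
          simp [pd]
        rw [← h1, hz, hz0, hz0]
      rw [lap_eq, lap_eq]
      linear_combination h3 0 + h3 1 - h2 0 - h2 1) h.contDiff_p h.per_p
  have : (fun x => (r x * (a 0 x + conv u 0 x)) ^ 2 + (r x * (a 1 x + conv u 1 x)) ^ 2)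
      = fun x => (lap (u 0) x ^ 2 + lap (u 1) x ^ 2)
        + (-2 * (lap (u 0) x * pd 0 p x + lap (u 1) x * pd 1 p x)
          + (pd 0 p x ^ 2 + pd 1 p x ^ 2)) := by
    funext x
    rw [h.pd_p_eq 0, h.pd_p_eq 1]
    ring
  rw [this, integral_add (integrable_torus (by fun_prop)) (integrable_torus (by fun_prop)),
    integral_add (integrable_torus (by fun_prop)) (integrable_torus (by fun_prop)),
    integral_add (integrable_torus (by fun_prop)) (integrable_torus (by fun_prop)),
    integral_const_mul, hp, integral_sq_lap (h.smooth_u 0) (h.per_u 0),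
    integral_sq_lap (h.smooth_u 1) (h.per_u 1), gradSq]
  ring

end Snapshot

/-! ### Bounds of the convective term at a fixed time -/

/-- The mean of f is recovered from the weighted integral up to a covariance, which the Poincaré
inequality controls. No lower bound of r is needed, so vacuum is allowed. -/
lemma integral_mul_eq_mean_add {r f : Plane → ℝ} (hr : Continuous r) (hf : Continuous f) :
    ∫ x, r x * f x ∂torus = (∫ x, r x ∂torus) * (∫ x, f x ∂torus)
      - ∫ x, ((∫ y, r y ∂torus) - r x) * (f x - ∫ y, f y ∂torus) ∂torus := by
  set M := ∫ x, r x ∂torus with hM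
  set m := ∫ x, f x ∂torus with hm
  have : (fun x => (M - r x) * (f x - m)) = fun x => (M * f x + m * r x) - (r x * f x + M * m) := by
    funext x
    ring
  rw [this, integral_sub (integrable_torus (by fun_prop)) (integrable_torus (by fun_prop)),
    integral_add (integrable_torus (by fun_prop)) (integrable_torus (by fun_prop)),
    integral_add (integrable_torus (by fun_prop)) (integrable_torus (by fun_prop)),
    integral_const_mul, integral_const_mul, ← hM, ← hm]
  simp
  ring

lemma sq_integral_weight_mul_le {r f : Plane → ℝ} (hr : Continuous r) (hr0 : ∀ x, 0 ≤ r x)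
    (hf : Continuous f) :
    (∫ x, r x * f x ∂torus) ^ 2 ≤ (∫ x, r x ∂torus) * ∫ x, r x * f x ^ 2 ∂torus := by
  have := sq_integral_mul_le_torus (f := fun x => √(r x)) (g := fun x => √(r x) * f x)
    (by fun_prop) (by fun_prop)
  simpa only [← mul_assoc, Real.mul_self_sqrt (hr0 _), mul_pow, Real.sq_sqrt (hr0 _)] using this

/-- Bound of the mean by the weighted mean square and the gradient. -/
lemma sq_mean_le {r f : Plane → ℝ} (hr : Continuous r) (hr0 : ∀ x, 0 ≤ r x)
    (hf : ContDiff ℝ 1 f) {M : ℝ} (hM : ∫ x, r x ∂torus = M) (hM0 : 0 < M) :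
    (∫ x, f x ∂torus) ^ 2 ≤ 2 / M * (∫ x, r x * f x ^ 2 ∂torus)
      + 4 * ((∫ x, (M - r x) ^ 2 ∂torus) / M ^ 2) * gradSq f := by
  have hfc := hf.continuous
  have e1 := integral_mul_eq_mean_add hr hfc
  have e2 := sq_integral_weight_mul_le hr hr0 hfc
  rw [hM] at e1 e2
  set m := ∫ x, f x ∂torus
  have e3 := sq_integral_mul_le_torus (f := fun x => M - r x) (g := fun x => f x - m)
    (by fun_prop) (by fun_prop)
  have e4 := integral_sq_sub_mean_le hf
  have e5 : 0 ≤ ∫ x, (M - r x) ^ 2 ∂torus := integral_nonneg fun x => sq_nonneg _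
  set Q := ∫ x, (M - r x) ^ 2 ∂torus
  set W := ∫ x, r x * f x ^ 2 ∂torus
  set Z := ∫ x, (M - r x) * (f x - m) ∂torus
  have e6 : Z ^ 2 ≤ Q * (2 * gradSq f) := e3.trans (mul_le_mul_of_nonneg_left e4 e5)
  have e7 : (M * m) ^ 2 ≤ 2 * (M * W) + 2 * (Q * (2 * gradSq f)) := by
    have : M * m = (∫ x, r x * f x ∂torus) + Z := by linarith
    rw [this]
    nlinarith [sq_nonneg ((∫ x, r x * f x ∂torus) - Z)]
  have e8 : m ^ 2 = (M * m) ^ 2 / M ^ 2 := by field_simp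
  rw [e8, div_le_iff₀ (by positivity)]
  refine e7.trans (le_of_eq ?_)
  field_simp
  ring

lemma sq_velocity_le {r : Plane → ℝ} {u : Fin 2 → Plane → ℝ} (hr : Continuous r)
    (hr0 : ∀ x, 0 ≤ r x) (hu : ∀ i, ContDiff ℝ 2 (u i)) (hup : ∀ i, IsPeriodic (u i))
    {M : ℝ} (hM : ∫ x, r x ∂torus = M) (hM0 : 0 < M) {δ : ℝ} (hδ : 0 < δ) (hδ1 : δ ≤ 1)
    (x : Plane) :
    u 0 x ^ 2 + u 1 x ^ 2 ≤ 4 / M * (∫ x, r x * (u 0 x ^ 2 + u 1 x ^ 2) ∂torus)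
      + (8 * ((∫ x, (M - r x) ^ 2 ∂torus) / M ^ 2) + 16 * Real.log (1 / δ) + 68)
          * (gradSq (u 0) + gradSq (u 1))
      + 256 * δ * √((gradSq (u 0) + gradSq (u 1)) * (hessSq (u 0) + hessSq (u 1))) := by
  have huc := fun i => (hu i).continuous
  have e1 := fun i => sq_mean_le hr hr0 ((hu i).of_le (by norm_num)) hM hM0
  have e2 := fun i => sq_sub_mean_le (hu i) (hup i) hδ hδ1 x
  have e3 : ∫ x, r x * (u 0 x ^ 2 + u 1 x ^ 2) ∂torus
      = (∫ x, r x * u 0 x ^ 2 ∂torus) + ∫ x, r x * u 1 x ^ 2 ∂torus := by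
    rw [← integral_add (integrable_torus (by fun_prop)) (integrable_torus (by fun_prop))]
    simp only [mul_add]
  have hX := fun i => gradSq_nonneg (u i)
  have hH := fun i => hessSq_nonneg (u i)
  have e4 : ∀ i, √(gradSq (u i) * hessSq (u i))
      ≤ √((gradSq (u 0) + gradSq (u 1)) * (hessSq (u 0) + hessSq (u 1))) := by
    intro i
    refine Real.sqrt_le_sqrt (mul_le_mul ?_ ?_ (hH i) (add_nonneg (hX 0) (hX 1)))
    · fin_cases i
      · simpa using hX 1
      · simpa using hX 0
    · fin_cases i
      · simpa using hH 1
      · simpa using hH 0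
  have e5 : ∀ i, u i x ^ 2 ≤ 2 * (∫ y, u i y ∂torus) ^ 2
      + 2 * (u i x - ∫ y, u i y ∂torus) ^ 2 := fun i => by
    nlinarith [sq_nonneg ((∫ y, u i y ∂torus) - (u i x - ∫ y, u i y ∂torus))]
  have e6 : ∀ i, 64 * δ * √(gradSq (u i) * hessSq (u i))
      ≤ 64 * δ * √((gradSq (u 0) + gradSq (u 1)) * (hessSq (u 0) + hessSq (u 1))) := fun i =>
    mul_le_mul_of_nonneg_left (e4 i) (by positivity)
  rw [e3]
  have h0 := e1 0
  have h1 := e1 1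
  have h2 := e2 0
  have h3 := e2 1
  have h4 := e5 0
  have h5 := e5 1
  have h6 := e6 0
  have h7 := e6 1
  have h8 : 4 / M = 2 * (2 / M) := by ring
  rw [h8]
  generalize (∫ x, (M - r x) ^ 2 ∂torus) / M ^ 2 = D at *
  generalize Real.log (1 / δ) = L at *
  linarith

/-- Cauchy–Schwarz for each component; the hints are the squares in Lagrange's identity. -/
lemma sq_conv_le (u : Fin 2 → Plane → ℝ) (x : Plane) :
    conv u 0 x ^ 2 + conv u 1 x ^ 2 ≤ (u 0 x ^ 2 + u 1 x ^ 2)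
      * ((pd 0 (u 0) x ^ 2 + pd 1 (u 0) x ^ 2) + (pd 0 (u 1) x ^ 2 + pd 1 (u 1) x ^ 2)) := by
  unfold conv
  nlinarith [sq_nonneg (u 0 x * pd 1 (u 0) x - u 1 x * pd 0 (u 0) x),
    sq_nonneg (u 0 x * pd 1 (u 1) x - u 1 x * pd 0 (u 1) x)]

/-- The constant of the differential inequality for the gradient, as a function of the mass, the
relative variance of the density, the kinetic energy, and the bound of the density. -/
def growthConst (M D E s : ℝ) : ℝ := 6 * s * (4 / M * E + 8 * D + 84 + 786432 * s ^ 2)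

/-- The supremum of |u|² is taken out of the integral and bounded with δ = 1/(e+X), for which
log(1/δ) = log(e+X) and δX ≤ 1. The weight 1/(8s) of the Hessian is small enough to be absorbed by
the dissipation in the differential inequality. -/
lemma integral_conv_le {r : Plane → ℝ} {u : Fin 2 → Plane → ℝ} (hr : Continuous r)
    (hr0 : ∀ x, 0 ≤ r x) (hu : ∀ i, ContDiff ℝ 2 (u i)) (hup : ∀ i, IsPeriodic (u i))
    {M : ℝ} (hM : ∫ x, r x ∂torus = M) (hM0 : 0 < M) {s : ℝ} (hs : ∀ x, r x ≤ s) (hs0 : 0 < s)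
    {X H E : ℝ} (hX : gradSq (u 0) + gradSq (u 1) = X) (hH : hessSq (u 0) + hessSq (u 1) = H)
    (hE : ∫ x, r x * (u 0 x ^ 2 + u 1 x ^ 2) ∂torus ≤ E) :
    6 * ∫ x, r x * (conv u 0 x ^ 2 + conv u 1 x ^ 2) ∂torus
      ≤ 1 / (8 * s) * H + growthConst M ((∫ x, (M - r x) ^ 2 ∂torus) / M ^ 2) E s
          * (X * ((Real.exp 1 + X) * Real.log (Real.exp 1 + X))) := by
  have hX0 : 0 ≤ X := hX ▸ add_nonneg (gradSq_nonneg _) (gradSq_nonneg _)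
  have hH0 : 0 ≤ H := hH ▸ add_nonneg (hessSq_nonneg _) (hessSq_nonneg _)
  have hexp : 2 < Real.exp 1 := by linarith [Real.exp_one_gt_d9]
  have hE0 : 0 ≤ E := le_trans (integral_nonneg fun x => by
    have := hr0 x
    simp only [Pi.zero_apply]
    positivity) hE
  set D := (∫ x, (M - r x) ^ 2 ∂torus) / M ^ 2 with hD
  have hD0 : 0 ≤ D := div_nonneg (integral_nonneg fun x => sq_nonneg _) (by positivity)
  set L := Real.log (Real.exp 1 + X) with hL
  have hL1 : 1 ≤ L := by
    rw [hL, Real.le_log_iff_exp_le (by linarith)]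
    linarith
  set δ := 1 / (Real.exp 1 + X) with hδ
  have hδ0 : 0 < δ := by positivity
  have hδ1 : δ ≤ 1 := by
    rw [hδ, div_le_one (by linarith)]
    linarith
  have hlog : Real.log (1 / δ) = L := by rw [hδ, one_div_one_div]
  set R := √(X * H) with hR
  have hR0 : 0 ≤ R := Real.sqrt_nonneg _
  set V := 4 / M * E + (8 * D + 16 * L + 68) * X + 256 * δ * R with hV
  have hV0 : 0 ≤ V := by positivity
  have hsup : ∀ x, u 0 x ^ 2 + u 1 x ^ 2 ≤ V := fun x => by
    have := sq_velocity_le hr hr0 hu hup hM hM0 hδ0 hδ1 x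
    rw [hX, hH, hlog, ← hD] at this
    refine this.trans ?_
    rw [hV]
    gcongr
  have huc := fun i => (hu i).continuous
  have hpc := fun k i => continuous_pd ((hu i).of_le (show (1 : WithTop ℕ∞) ≤ 2 by norm_num)) k
  have hB : ∫ x, r x * (conv u 0 x ^ 2 + conv u 1 x ^ 2) ∂torus ≤ s * V * X := by
    have e1 : X = ∫ x, (pd 0 (u 0) x ^ 2 + pd 1 (u 0) x ^ 2)
        + (pd 0 (u 1) x ^ 2 + pd 1 (u 1) x ^ 2) ∂torus := by
      rw [integral_add (integrable_torus (by fun_prop)) (integrable_torus (by fun_prop)), ← hX]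
      rfl
    have hcc : ∀ i, Continuous (conv u i) := fun i => by
      unfold conv
      fun_prop
    rw [e1, ← integral_const_mul]
    refine integral_mono (integrable_torus (by fun_prop)) (integrable_torus (by fun_prop))
      fun x => ?_
    have e2 := sq_conv_le u x
    dsimp only
    calc _ ≤ s * ((u 0 x ^ 2 + u 1 x ^ 2)
      * ((pd 0 (u 0) x ^ 2 + pd 1 (u 0) x ^ 2) + (pd 0 (u 1) x ^ 2 + pd 1 (u 1) x ^ 2))) :=
          mul_le_mul (hs x) e2 (by positivity) hs0.le
      _ ≤ s * (V * ((pd 0 (u 0) x ^ 2 + pd 1 (u 0) x ^ 2)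
            + (pd 0 (u 1) x ^ 2 + pd 1 (u 1) x ^ 2))) := by
          gcongr
          exact hsup x
      _ = _ := by ring
  have hδX : δ * X ≤ 1 := by
    rw [hδ, one_div_mul_eq_div, div_le_one (by linarith)]
    linarith
  -- Weighted arithmetic-geometric mean inequality with l = 3072 s². This l is chosen so that 6s ·
  -- 64H/l = H/(8s), and 256 · 3072 = 786432 is the last constant in `growthConst`.
  have hRle : 256 * R ≤ 256 * (3072 * s ^ 2) * X + 64 * H / (3072 * s ^ 2) := by
    have hR2 : R ^ 2 = X * H := Real.sq_sqrt (mul_nonneg hX0 hH0)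
    have hl : 0 < 3072 * s ^ 2 := by positivity
    generalize 3072 * s ^ 2 = l at *
    have e2 : 64 * H / l * l = 64 * H := by field_simp
    refine le_of_sq_le_sq ?_ (by positivity)
    have h3 : (256 * l * X + 64 * H / l) ^ 2
        = (256 * l * X - 64 * H / l) ^ 2 + 4 * 256 * X * (64 * H / l * l) := by ring
    rw [h3, e2]
    nlinarith [sq_nonneg (256 * l * X - 64 * H / l)]
  have hVX : V * X ≤ (4 / M * E + 8 * D + 84 + 786432 * s ^ 2)
      * (X * ((Real.exp 1 + X) * L)) + 64 * H / (3072 * s ^ 2) := by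
    have e1 : V * X = 4 / M * E * X + (8 * D + 16 * L + 68) * (X * X) + 256 * R * (δ * X) := by
      rw [hV]; ring
    have e2 : 256 * R * (δ * X) ≤ 256 * R := mul_le_of_le_one_right (by positivity) hδX
    have e3 : X ≤ X * ((Real.exp 1 + X) * L) := by
      refine le_mul_of_one_le_right hX0 (one_le_mul_of_one_le_of_one_le (by linarith) hL1)
    have e4 : (8 * D + 16 * L + 68) * (X * X) ≤ (8 * D + 84) * (X * ((Real.exp 1 + X) * L)) := by
      -- Since L ≥ 1, the constant terms may be multiplied by L; 84 = 16 + 68.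
      have e5 : 8 * D + 16 * L + 68 ≤ (8 * D + 84) * L := by nlinarith
      calc _ ≤ (8 * D + 84) * L * (X * (Real.exp 1 + X)) := by
            gcongr
            linarith
        _ = _ := by ring
    have e5 : 4 / M * E * X ≤ 4 / M * E * (X * ((Real.exp 1 + X) * L)) :=
      mul_le_mul_of_nonneg_left e3 (by positivity)
    have e6 : 256 * (3072 * s ^ 2) * X ≤ 256 * (3072 * s ^ 2) * (X * ((Real.exp 1 + X) * L)) :=
      mul_le_mul_of_nonneg_left e3 (by positivity)
    rw [e1]
    nlinarith
  calc _ ≤ 6 * (s * V * X) := by linarith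
    _ = 6 * s * (V * X) := by ring
    _ ≤ 6 * s * ((4 / M * E + 8 * D + 84 + 786432 * s ^ 2)
      * (X * ((Real.exp 1 + X) * L)) + 64 * H / (3072 * s ^ 2)) := by gcongr
    _ = _ := by
      unfold growthConst
      field_simp
      ring

/-- The differential inequality for the gradient, at a fixed time. -/
lemma Snapshot.gradient_inequality {r r' : Plane → ℝ} {u a : Fin 2 → Plane → ℝ} {p : Plane → ℝ}
    (h : Snapshot r r' u a p) (hr0 : ∀ x, 0 ≤ r x)
    {M : ℝ} (hM : ∫ x, r x ∂torus = M) (hM0 : 0 < M) {s : ℝ} (hs : ∀ x, r x ≤ s) (hs0 : 0 < s)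
    {X H E : ℝ} (hX : gradSq (u 0) + gradSq (u 1) = X) (hH : hessSq (u 0) + hessSq (u 1) = H)
    (hE : ∫ x, r x * (u 0 x ^ 2 + u 1 x ^ 2) ∂torus ≤ E) :
    (∫ x, -2 * r x * (a 0 x * (a 0 x + conv u 0 x) + a 1 x * (a 1 x + conv u 1 x)) ∂torus)
      + 1 / 2 * ((∫ x, r x * (a 0 x ^ 2 + a 1 x ^ 2) ∂torus) + 1 / s * (H + gradSq p))
      ≤ growthConst M ((∫ x, (M - r x) ^ 2 ∂torus) / M ^ 2) E s
          * (X * ((Real.exp 1 + X) * Real.log (Real.exp 1 + X))) := by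
  have hcr := h.smooth_r.continuous
  have hca := fun i => (h.smooth_a i).continuous
  have hcc := fun i => (h.smooth_conv i).continuous
  have hB := integral_conv_le hcr hr0 (fun i => (h.smooth_u i).of_le two_le) h.per_u hM hM0 hs hs0
    hX hH hE
  have hS := h.integral_stokes
  rw [hH] at hS
  set A := ∫ x, r x * (a 0 x ^ 2 + a 1 x ^ 2) ∂torus
  set B := ∫ x, r x * (conv u 0 x ^ 2 + conv u 1 x ^ 2) ∂torus
  have e1 : H + gradSq p ≤ s * (2 * A + 2 * B) := by
    rw [← hS, ← integral_const_mul, ← integral_const_mul,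
      ← integral_add (integrable_torus (by fun_prop)) (integrable_torus (by fun_prop)),
      ← integral_const_mul]
    refine integral_mono (integrable_torus (by fun_prop)) (integrable_torus (by fun_prop))
      fun x => ?_
    dsimp only
    have e2 : (r x * (a 0 x + conv u 0 x)) ^ 2 + (r x * (a 1 x + conv u 1 x)) ^ 2
        = r x * (r x * ((a 0 x + conv u 0 x) ^ 2 + (a 1 x + conv u 1 x) ^ 2)) := by ring
    rw [e2]
    refine mul_le_mul (hs x) ?_ (mul_nonneg (hr0 x) (by positivity)) hs0.le
    have e3 : 2 * (r x * (a 0 x ^ 2 + a 1 x ^ 2)) + 2 * (r x * (conv u 0 x ^ 2 + conv u 1 x ^ 2))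
        = r x * (2 * (a 0 x ^ 2 + a 1 x ^ 2) + 2 * (conv u 0 x ^ 2 + conv u 1 x ^ 2)) := by ring
    rw [e3]
    refine mul_le_mul_of_nonneg_left ?_ (hr0 x)
    nlinarith [sq_nonneg (a 0 x - conv u 0 x), sq_nonneg (a 1 x - conv u 1 x)]
  -- Young's inequality: the difference of the two integrands is r|a + 4 u·∇u|²/4.
  have e2 : ∫ x, -2 * r x * (a 0 x * (a 0 x + conv u 0 x) + a 1 x * (a 1 x + conv u 1 x)) ∂torus
      ≤ -(7 / 4) * A + 4 * B := by
    rw [← integral_const_mul, ← integral_const_mul,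
      ← integral_add (integrable_torus (by fun_prop)) (integrable_torus (by fun_prop))]
    refine integral_mono (integrable_torus (by fun_prop)) (integrable_torus (by fun_prop))
      fun x => ?_
    dsimp only
    have := hr0 x
    nlinarith [mul_nonneg this (sq_nonneg (a 0 x + 4 * conv u 0 x)),
      mul_nonneg this (sq_nonneg (a 1 x + 4 * conv u 1 x))]
  have hP : 0 ≤ gradSq p := gradSq_nonneg p
  have hH0 : 0 ≤ H := hH ▸ add_nonneg (hessSq_nonneg _) (hessSq_nonneg _)
  have hB0 : 0 ≤ B := integral_nonneg fun x => mul_nonneg (hr0 x) (by positivity)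
  have e3 : 1 / s * (H + gradSq p) ≤ 2 * A + 2 * B := by
    rw [one_div_mul_eq_div, div_le_iff₀ hs0]
    linarith
  have e4 : 1 / (8 * s) * H ≤ 1 / 8 * (1 / s * (H + gradSq p)) := by
    have : 1 / (8 * s) * H = 1 / 8 * (1 / s * H) := by ring
    rw [this]
    gcongr
    linarith
  -- With S = (H + ‖∇p‖²)/s ≤ 2A + 2B, the left side is at most -(5/4)A + 4B + S/2. Adding and
  -- subtracting S/8 and using (5/8)S ≤ (5/4)(A + B) cancels A and leaves (21/4)B - S/8. This is at
  -- most 6B - H/(8s), the quantity bounded in `hB`.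
  linarith

/-! ### A doubly logarithmic Gronwall lemma -/

/-- The function log log Y + (K/2)E is nonincreasing: the inequality gives (log log Y)' ≤ KX, and E'
= -2X compensates it exactly. Starting Y at e + X keeps log Y ≥ 1. Continuity of I on an open
neighbourhood makes the integral differentiable at both end points. -/
lemma log_log_gronwall {s t K : ℝ} (hst : s ≤ t) {X X' I E : ℝ → ℝ} (hK : 0 ≤ K)
    (hX : ∀ τ ∈ Set.Icc s t, 0 ≤ X τ) (hI : ∀ τ ∈ Set.Icc s t, 0 ≤ I τ)
    (hE : ∀ τ ∈ Set.Icc s t, 0 ≤ E τ)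
    (hIc : ∃ U, IsOpen U ∧ Set.Icc s t ⊆ U ∧ ContinuousOn I U)
    (hX' : ∀ τ ∈ Set.Icc s t, HasDerivAt X (X' τ) τ)
    (hE' : ∀ τ ∈ Set.Icc s t, HasDerivAt E (-2 * X τ) τ)
    (hle : ∀ τ ∈ Set.Icc s t, X' τ + 1 / 2 * I τ
      ≤ K * (X τ * ((Real.exp 1 + X τ) * Real.log (Real.exp 1 + X τ)))) :
    Real.exp 1 + X t + 1 / 2 * ∫ τ in s..t, I τ
      ≤ (Real.exp 1 + X s) ^ Real.exp (K / 2 * E s) := by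
  obtain ⟨U, hU, hsub, hIU⟩ := hIc
  have hs : s ∈ Set.Icc s t := ⟨le_rfl, hst⟩
  have ht : t ∈ Set.Icc s t := ⟨hst, le_rfl⟩
  set Y := fun τ => Real.exp 1 + X τ + 1 / 2 * ∫ σ in s..τ, I σ with hYdef
  have hint : ∀ τ ∈ Set.Icc s t, IntervalIntegrable I volume s τ := fun τ hτ =>
    (hIU.mono ((Set.Icc_subset_Icc_right hτ.2).trans hsub)).intervalIntegrable_of_Icc hτ.1
  have hYX : ∀ τ ∈ Set.Icc s t, Real.exp 1 + X τ ≤ Y τ := fun τ hτ => by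
    have : 0 ≤ ∫ σ in s..τ, I σ :=
      intervalIntegral.integral_nonneg hτ.1 fun σ hσ => hI σ ⟨hσ.1, hσ.2.trans hτ.2⟩
    simp only [hYdef]
    linarith
  have hYe : ∀ τ ∈ Set.Icc s t, Real.exp 1 ≤ Y τ := fun τ hτ => by
    linarith [hYX τ hτ, hX τ hτ]
  have hY0 : ∀ τ ∈ Set.Icc s t, 0 < Y τ := fun τ hτ => (Real.exp_pos 1).trans_le (hYe τ hτ)
  have hlogY : ∀ τ ∈ Set.Icc s t, 1 ≤ Real.log (Y τ) := fun τ hτ =>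
    (Real.le_log_iff_exp_le (hY0 τ hτ)).2 (hYe τ hτ)
  have hYd : ∀ τ ∈ Set.Icc s t, HasDerivAt Y (X' τ + 1 / 2 * I τ) τ := fun τ hτ => by
    have hca : ContinuousAt I τ := hIU.continuousAt (hU.mem_nhds (hsub hτ))
    have h1 := intervalIntegral.integral_hasDerivAt_right (hint τ hτ)
      (hIU.stronglyMeasurableAtFilter hU τ (hsub hτ)) hca
    exact ((hX' τ hτ).const_add _).add (h1.const_mul _)
  have hφd : ∀ τ ∈ Set.Icc s t, HasDerivAt (fun τ => Real.log (Real.log (Y τ)) + K / 2 * E τ)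
      ((X' τ + 1 / 2 * I τ) / Y τ / Real.log (Y τ) + K / 2 * (-2 * X τ)) τ := fun τ hτ =>
    (((hYd τ hτ).log (hY0 τ hτ).ne').log (by linarith [hlogY τ hτ])).add
      ((hE' τ hτ).const_mul _)
  have hanti : AntitoneOn (fun τ => Real.log (Real.log (Y τ)) + K / 2 * E τ) (Set.Icc s t) := by
    refine antitoneOn_of_deriv_nonpos (convex_Icc s t)
      (fun τ hτ => (hφd τ hτ).continuousAt.continuousWithinAt)
      (fun τ hτ => (hφd τ (interior_subset hτ)).differentiableAt.differentiableWithinAt)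
      fun τ hτ' => ?_
    have hτ := interior_subset hτ'
    rw [(hφd τ hτ).deriv]
    have h1 : (X' τ + 1 / 2 * I τ) / Y τ / Real.log (Y τ) ≤ K * X τ := by
      have hl0 : 0 < Real.log (Y τ) := by linarith [hlogY τ hτ]
      rw [div_div, div_le_iff₀ (mul_pos (hY0 τ hτ) hl0)]
      refine (hle τ hτ).trans ?_
      rw [mul_assoc K]
      have hX0 := hX τ hτ
      have hb : 0 < Real.exp 1 + X τ := by positivity
      have h2 : Real.log (Real.exp 1 + X τ) ≤ Real.log (Y τ) :=
        Real.log_le_log hb (hYX τ hτ)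
      have h3 : 0 ≤ Real.log (Real.exp 1 + X τ) := Real.log_nonneg
        (by linarith [Real.add_one_le_exp 1])
      refine mul_le_mul_of_nonneg_left ?_ hK
      refine mul_le_mul_of_nonneg_left ?_ hX0
      exact mul_le_mul (hYX τ hτ) h2 h3 (hY0 τ hτ).le
    linarith
  have h1 := hanti hs ht hst
  have hYs : Y s = Real.exp 1 + X s := by simp [hYdef]
  -- The nonnegative term (K/2)E(t) is dropped.
  have h2 : Real.log (Real.log (Y t)) ≤ Real.log (Real.log (Y s)) + K / 2 * E s := by
    have hKE := mul_nonneg (by linarith : 0 ≤ K / 2) (hE t ht)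
    dsimp only at h1
    linarith
  have hls := hlogY s hs
  have hlt := hlogY t ht
  have h3 : Real.log (Y t) ≤ Real.log (Y s) * Real.exp (K / 2 * E s) := by
    have := Real.exp_le_exp.2 h2
    rwa [Real.exp_add, Real.exp_log (by linarith), Real.exp_log (by linarith)] at this
  have h4 := Real.exp_le_exp.2 h3
  rw [Real.exp_log (hY0 t ht), ← Real.rpow_def_of_pos (hY0 s hs), hYs] at h4
  exact h4

/-- The differential relations hold only at positive times, so the Gronwall bound is used on [s,t]
and s tends to 0. -/
lemma gradient_bound_of_differential_inequality {T K : ℝ} {X X' I E : ℝ → ℝ} (hK : 0 ≤ K)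
    (hX : ∀ t ∈ Set.Ico 0 T, 0 ≤ X t) (hE : ∀ t ∈ Set.Ico 0 T, 0 ≤ E t)
    (hXc : ContinuousOn X (Set.Ico 0 T)) (hEc : ContinuousOn E (Set.Ico 0 T))
    (hI : ∀ t ∈ Set.Ioo 0 T, 0 ≤ I t) (hIc : ContinuousOn I (Set.Ioo 0 T))
    (hX' : ∀ t ∈ Set.Ioo 0 T, HasDerivAt X (X' t) t)
    (hE' : ∀ t ∈ Set.Ioo 0 T, HasDerivAt E (-2 * X t) t)
    (hle : ∀ t ∈ Set.Ioo 0 T, X' t + 1 / 2 * I t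
      ≤ K * (X t * ((Real.exp 1 + X t) * Real.log (Real.exp 1 + X t)))) {t : ℝ}
    (ht : t ∈ Set.Ico 0 T) :
    X t + 1 / 2 * ∫ τ in (0 : ℝ)..t, I τ
      ≤ (Real.exp 1 + X 0) ^ Real.exp (K / 2 * E 0) - Real.exp 1 := by
  have h0T : (0 : ℝ) ∈ Set.Ico 0 T := ⟨le_rfl, ht.1.trans_lt ht.2⟩
  rcases ht.1.eq_or_lt with rfl | ht0
  · have hX0 := hX 0 h0T
    have h1 : 1 ≤ Real.exp (K / 2 * E 0) :=
      Real.one_le_exp (mul_nonneg (by linarith) (hE 0 h0T))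
    have h2 := Real.rpow_le_rpow_of_exponent_le
      (x := Real.exp 1 + X 0) (by linarith [Real.add_one_le_exp 1]) h1
    rw [Real.rpow_one] at h2
    simp only [intervalIntegral.integral_same]
    linarith
  set F := fun s => (Real.exp 1 + X s) ^ Real.exp (K / 2 * E s) with hF
  have hsubT : Set.Icc 0 t ⊆ Set.Ico 0 T := fun s hs => ⟨hs.1, hs.2.trans_lt ht.2⟩
  have hFc : ContinuousOn F (Set.Icc 0 t) := by
    refine ContinuousOn.rpow ((continuousOn_const).add (hXc.mono hsubT))
      (Real.continuous_exp.comp_continuousOn (continuousOn_const.mul (hEc.mono hsubT)))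
      fun s hs => Or.inl ?_
    linarith [hX s (hsubT hs), Real.exp_pos 1]
  have hIoo : ∀ s, 0 < s → Set.Icc s t ⊆ Set.Ioo 0 T := fun s hs τ hτ =>
    ⟨hs.trans_le hτ.1, hτ.2.trans_lt ht.2⟩
  have key : ∀ s ∈ Set.Ioo 0 t, Real.exp 1 + X t + 1 / 2 * ∫ τ in s..t, I τ ≤ F s := by
    intro s hs
    have hsub := hIoo s hs.1
    exact log_log_gronwall hs.2.le hK (fun τ hτ => hX τ ⟨(hsub hτ).1.le, (hsub hτ).2⟩)
      (fun τ hτ => hI τ (hsub hτ)) (fun τ hτ => hE τ ⟨(hsub hτ).1.le, (hsub hτ).2⟩)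
      ⟨_, isOpen_Ioo, hsub, hIc⟩ (fun τ hτ => hX' τ (hsub hτ)) (fun τ hτ => hE' τ (hsub hτ))
      (fun τ hτ => hle τ (hsub hτ))
  obtain ⟨C, hC⟩ := isCompact_Icc.exists_bound_of_continuousOn hFc
  -- Nothing is assumed about I near 0. The Gronwall bound on [s,t] is uniform in s and I is
  -- nonnegative, which gives integrability up to 0; without it, the integral from 0 would be the
  -- default value 0 and not the limit. In t/(n+2), the 2 keeps the points strictly below t already
  -- at n = 0.
  have hint : IntegrableOn I (Set.Ioc 0 t) := by
    have ha : ∀ n : ℕ, t / (n + 2) ∈ Set.Ioo 0 t := fun n => by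
      have : (0 : ℝ) < n + 2 := by positivity
      refine ⟨by positivity, ?_⟩
      rw [div_lt_iff₀ this]
      nlinarith [(Nat.cast_nonneg n : (0 : ℝ) ≤ n)]
    have hlim : Filter.Tendsto (fun n : ℕ => t / ((n : ℝ) + 2)) Filter.atTop (nhds 0) :=
      tendsto_const_nhds.div_atTop
        (Filter.tendsto_atTop_add_const_right _ _ tendsto_natCast_atTop_atTop)
    refine integrableOn_Ioc_of_intervalIntegral_norm_bounded_left (I := 2 * C)
      (a := fun n : ℕ => t / ((n : ℝ) + 2)) (l := Filter.atTop) (fun n => ?_) hlim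
      (Filter.Eventually.of_forall fun n => ?_)
    · exact (hIc.mono (hIoo _ (ha n).1)).integrableOn_Icc.mono_set Set.Ioc_subset_Icc_self
    · have e1 := key _ (ha n)
      have e2 := hC _ ⟨(ha n).1.le, (ha n).2.le⟩
      rw [intervalIntegral.integral_of_le (ha n).2.le] at e1
      have e3 : ∫ x in Set.Ioc (t / ((n : ℝ) + 2)) t, ‖I x‖
          = ∫ x in Set.Ioc (t / ((n : ℝ) + 2)) t, I x := by
        refine setIntegral_congr_fun measurableSet_Ioc fun x hx => ?_
        exact Real.norm_of_nonneg (hI x (hIoo _ (ha n).1 (Set.Ioc_subset_Icc_self hx)))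
      rw [e3]
      have e4 := (le_abs_self _).trans e2
      linarith [hX t ht, Real.exp_pos 1]
  have hu : Set.uIcc 0 t = Set.Icc 0 t := Set.uIcc_of_le ht0.le
  have hprim : ContinuousOn (fun s => ∫ τ in s..t, I τ) (Set.Icc 0 t) := by
    have := intervalIntegral.continuousOn_primitive_interval_left (f := I) (a := 0) (b := t)
      (μ := volume) (by rw [hu, integrableOn_Icc_iff_integrableOn_Ioc]; exact hint)
    rwa [hu] at this
  have hz : (0 : ℝ) ∈ Set.Icc 0 t := ⟨le_rfl, ht0.le⟩
  have : (nhdsWithin (0 : ℝ) (Set.Ioo 0 t)).NeBot := by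
    rw [nhdsWithin_Ioo_eq_nhdsGT ht0]
    infer_instance
  have hl1 := ((hprim 0 hz).mono Set.Ioo_subset_Icc_self).tendsto
  have hl2 := ((hFc 0 hz).mono Set.Ioo_subset_Icc_self).tendsto
  have := le_of_tendsto_of_tendsto ((hl1.const_mul (1 / 2)).const_add (Real.exp 1 + X t)) hl2
    (eventually_mem_nhdsWithin.mono key)
  linarith

/-! ### Norms of vector fields in terms of their components -/

lemma continuous_gradV {w : Plane → Plane} (hw : ∀ i, ContDiff ℝ 1 fun x => w x i) :
    Continuous (gradV w) :=
  (PiLp.continuous_toLp 2 _).comp (continuous_pi fun a => continuous_pd (hw a.1) a.2)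

lemma normLp_gradV_sq {w : Plane → Plane} (hw : ∀ i, ContDiff ℝ 1 fun x => w x i) :
    normLp 2 (gradV w) ^ 2 = gradSq (fun x => w x 0) + gradSq (fun x => w x 1) := by
  have h := fun k i => continuous_pd (hw i) k
  rw [normLp_two_sq (continuous_gradV hw), gradSq, gradSq,
    ← integral_add (integrable_torus (by fun_prop)) (integrable_torus (by fun_prop))]
  congr 1
  funext x
  simp [EuclideanSpace.norm_sq_eq, gradV, Fintype.sum_prod_type]

lemma normLp_hessV_sq {w : Plane → Plane} (hw : ∀ i, ContDiff ℝ 2 fun x => w x i) :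
    normLp 2 (hessV w) ^ 2 = hessSq (fun x => w x 0) + hessSq (fun x => w x 1) := by
  have h : ∀ k j i, Continuous (pd k (pd j fun x => w x i)) := fun k j i =>
    continuous_pd (contDiff_pd (hw i) (by norm_num) j) k
  have hc : Continuous (hessV w) :=
    (PiLp.continuous_toLp 2 _).comp (continuous_pi fun a => h a.2.2 a.2.1 a.1)
  rw [normLp_two_sq hc, hessSq, hessSq,
    ← integral_add (integrable_torus (by fun_prop)) (integrable_torus (by fun_prop))]
  congr 1
  funext x
  simp [EuclideanSpace.norm_sq_eq, hessV, Fintype.sum_prod_type]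
  ring

lemma normLp_grad_sq {f : Plane → ℝ} (hf : ContDiff ℝ 1 f) : normLp 2 (grad f) ^ 2 = gradSq f := by
  have hc : Continuous (grad f) :=
    (PiLp.continuous_toLp 2 _).comp (continuous_pi fun k => continuous_pd hf k)
  rw [normLp_two_sq hc, gradSq]
  congr 1
  funext x
  simp [EuclideanSpace.norm_sq_eq, grad]

lemma continuous_of_components {w : Plane → Plane} (hw : ∀ i, Continuous fun x => w x i) :
    Continuous w :=
  (PiLp.continuous_toLp 2 fun _ : Fin 2 => ℝ).comp (continuous_pi hw)

lemma weightedNorm_sq {r : Plane → ℝ} {w : Plane → Plane} (hr : Continuous r)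
    (hr0 : ∀ x, 0 ≤ r x) (hw : ∀ i, Continuous fun x => w x i) :
    weightedNorm r w ^ 2 = ∫ x, r x * (w x 0 ^ 2 + w x 1 ^ 2) ∂torus := by
  have hwc := continuous_of_components hw
  rw [weightedNorm, normLp_two_sq (by fun_prop)]
  congr 1
  funext x
  rw [norm_smul, mul_pow, Real.norm_eq_abs, sq_abs, Real.sq_sqrt (hr0 x),
    EuclideanSpace.norm_sq_eq]
  simp

/-! ### Smooth solutions -/

/-- Components of a time dependent vector field. -/
def comp (v : ℝ → Plane → Plane) (i : Fin 2) (t : ℝ) (x : Plane) : ℝ := v t x i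

lemma isPeriodic_dt {T : ℝ} {G : ℝ → Plane → ℝ} (hG : ∀ t ∈ Set.Ico 0 T, IsPeriodic (G t))
    {t : ℝ} (ht : t ∈ Set.Ioo 0 T) : IsPeriodic (dt G t) := by
  intro k x
  refine Filter.EventuallyEq.deriv_eq ?_
  filter_upwards [isOpen_Ioo.mem_nhds ht] with s hs
  exact hG s (Set.Ioo_subset_Ico_self hs) k x

lemma eq_initial_of_deriv_zero {T : ℝ} {f : ℝ → ℝ} (hc : ContinuousOn f (Set.Ico 0 T))
    (hd : ∀ t ∈ Set.Ioo 0 T, HasDerivAt f 0 t) {t : ℝ} (ht : t ∈ Set.Ico 0 T) : f t = f 0 := by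
  have h0 : (0 : ℝ) ∈ Set.Ico 0 T := ⟨le_rfl, ht.1.trans_lt ht.2⟩
  have hd' : ∀ s ∈ interior (Set.Ico 0 T), HasDerivAt f 0 s := fun s hs =>
    hd s (by rwa [interior_Ico] at hs)
  have hdiff : DifferentiableOn ℝ f (interior (Set.Ico 0 T)) := fun s hs =>
    (hd' s hs).differentiableAt.differentiableWithinAt
  exact le_antisymm
    (antitoneOn_of_deriv_nonpos (convex_Ico 0 T) hc hdiff (fun s hs => (hd' s hs).deriv.le)
      h0 ht ht.1)
    (monotoneOn_of_deriv_nonneg (convex_Ico 0 T) hc hdiff (fun s hs => (hd' s hs).deriv.ge)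
      h0 ht ht.1)

namespace IsSmoothSolution

variable {T : ℝ} {ρ : ℝ → Plane → ℝ} {v : ℝ → Plane → Plane} {P : ℝ → Plane → ℝ}

lemma smoothOn_density (h : IsSmoothSolution T ρ v P) : SmoothOn (Set.Ico 0 T) ρ :=
  h.smooth_density

lemma smoothOn_comp (h : IsSmoothSolution T ρ v P) (i : Fin 2) :
    SmoothOn (Set.Ico 0 T) (comp v i) :=
  (EuclideanSpace.proj i : Plane →L[ℝ] ℝ).contDiff.comp_contDiffOn
    h.smooth_velocity

lemma smoothOn_pd_comp (h : IsSmoothSolution T ρ v P) (k i : Fin 2) :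
    SmoothOn (Set.Ico 0 T) fun t => pd k (comp v i t) :=
  (h.smoothOn_comp i).pd (uniqueDiffOn_Ico 0 T) k

lemma smoothOn_density' (h : IsSmoothSolution T ρ v P) : SmoothOn (Set.Ioo 0 T) ρ :=
  h.smoothOn_density.mono Set.Ioo_subset_Ico_self

lemma smoothOn_comp' (h : IsSmoothSolution T ρ v P) (i : Fin 2) :
    SmoothOn (Set.Ioo 0 T) (comp v i) := (h.smoothOn_comp i).mono Set.Ioo_subset_Ico_self

lemma smoothOn_pd_comp' (h : IsSmoothSolution T ρ v P) (k i : Fin 2) :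
    SmoothOn (Set.Ioo 0 T) fun t => pd k (comp v i t) :=
  (h.smoothOn_pd_comp k i).mono Set.Ioo_subset_Ico_self

lemma dt_apply (h : IsSmoothSolution T ρ v P) {t : ℝ} (ht : t ∈ Set.Ioo 0 T) (x : Plane)
    (i : Fin 2) : dt v t x i = dt (comp v i) t x := by
  have h1 : ContDiffAt ℝ ∞ (fun z : ℝ × Plane => v z.1 z.2) (t, x) :=
    (h.smooth_velocity.mono (Set.prod_mono Set.Ioo_subset_Ico_self subset_rfl)).contDiffAt
      ((isOpen_Ioo.prod isOpen_univ).mem_nhds ⟨ht, trivial⟩)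
  have h2 : DifferentiableAt ℝ (fun s => v s x) t :=
    DifferentiableAt.comp (g := fun z : ℝ × Plane => v z.1 z.2) (f := fun s : ℝ => (s, x)) t
      (h1.differentiableAt (by simp)) (by fun_prop)
  have h3 := (EuclideanSpace.proj i : Plane →L[ℝ] ℝ).hasFDerivAt.comp_hasDerivAt
    t h2.hasDerivAt
  exact h3.deriv.symm

lemma isPeriodic_comp (h : IsSmoothSolution T ρ v P) (i : Fin 2) {t : ℝ} (ht : t ∈ Set.Ico 0 T) :
    IsPeriodic (comp v i t) := fun k x => by
  simp only [comp, h.periodic_velocity t ht k x]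

lemma divergence_free (h : IsSmoothSolution T ρ v P) {t : ℝ} (ht : t ∈ Set.Ioo 0 T) (x : Plane) :
    pd 0 (comp v 0 t) x + pd 1 (comp v 1 t) x = 0 := by
  have := h.incompressible t ht x
  simp only [divg, Fin.sum_univ_two] at this
  exact this

/-- Differentiate div v = 0 in time and exchange the derivatives. -/
lemma divergence_free_dt (h : IsSmoothSolution T ρ v P) {t : ℝ} (ht : t ∈ Set.Ioo 0 T)
    (x : Plane) : pd 0 (dt (comp v 0) t) x + pd 1 (dt (comp v 1) t) x = 0 := by
  rw [← (h.smoothOn_comp' 0).dt_pd isOpen_Ioo ht, ← (h.smoothOn_comp' 1).dt_pd isOpen_Ioo ht]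
  have h1 := ((h.smoothOn_pd_comp' 0 0).hasDerivAt isOpen_Ioo ht x).add
    ((h.smoothOn_pd_comp' 1 1).hasDerivAt isOpen_Ioo ht x)
  have h2 : HasDerivAt (fun _ : ℝ => (0 : ℝ)) 0 t := hasDerivAt_const t 0
  refine h1.unique (h2.congr_of_eventuallyEq ?_)
  filter_upwards [isOpen_Ioo.mem_nhds ht] with s hs
  exact h.divergence_free hs x

lemma snapshot (h : IsSmoothSolution T ρ v P) {t : ℝ} (ht : t ∈ Set.Ioo 0 T) :
    Snapshot (ρ t) (dt ρ t) (fun i => comp v i t) (fun i => dt (comp v i) t) (P t) where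
  smooth_r := h.smoothOn_density'.slice ht
  smooth_u i := (h.smoothOn_comp' i).slice ht
  smooth_a i := ((h.smoothOn_comp' i).dt isOpen_Ioo).slice ht
  diff_p := h.differentiable_pressure t ht
  per_r := h.periodic_density t (Set.Ioo_subset_Ico_self ht)
  per_u i := h.isPeriodic_comp i (Set.Ioo_subset_Ico_self ht)
  per_a i := isPeriodic_dt (fun _ hs => h.isPeriodic_comp i hs) ht
  per_p := h.periodic_pressure t ht
  div_u := h.divergence_free ht
  div_a := h.divergence_free_dt ht
  transport x := by simpa [comp] using h.transport t ht x
  momentum i x := by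
    have := h.momentum t ht x i
    simp only [h.dt_apply ht, Fin.sum_univ_two] at this
    exact this

/-! ### Conservation laws -/

lemma integral_density (h : IsSmoothSolution T ρ v P) {t : ℝ} (ht : t ∈ Set.Ico 0 T) :
    ∫ x, ρ t x ∂torus = mass (ρ 0) :=
  eq_initial_of_deriv_zero h.smoothOn_density.continuousOn_integral (fun s hs => by
    rw [← (h.snapshot hs).integral_transport]
    exact h.smoothOn_density'.hasDerivAt_integral isOpen_Ioo hs) ht

lemma integral_density_sq (h : IsSmoothSolution T ρ v P) {t : ℝ} (ht : t ∈ Set.Ico 0 T) :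
    ∫ x, ρ t x ^ 2 ∂torus = ∫ x, ρ 0 x ^ 2 ∂torus :=
  eq_initial_of_deriv_zero (f := fun t => ∫ x, ρ t x ^ 2 ∂torus)
    (h.smoothOn_density.pow 2).continuousOn_integral (fun s hs => by
    rw [← (h.snapshot hs).integral_transport_sq]
    convert (h.smoothOn_density'.pow 2).hasDerivAt_integral isOpen_Ioo hs using 2
    funext x
    have := ((h.smoothOn_density'.hasDerivAt isOpen_Ioo hs x).pow 2).deriv
    simpa [dt, Pi.pow_def] using this.symm) ht

lemma integral_density_mul_comp (h : IsSmoothSolution T ρ v P) (i : Fin 2) {t : ℝ}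
    (ht : t ∈ Set.Ico 0 T) :
    ∫ x, ρ t x * comp v i t x ∂torus = ∫ x, ρ 0 x * comp v i 0 x ∂torus :=
  eq_initial_of_deriv_zero (f := fun t => ∫ x, ρ t x * comp v i t x ∂torus)
    (h.smoothOn_density.mul (h.smoothOn_comp i)).continuousOn_integral (fun s hs => by
    rw [← (h.snapshot hs).integral_momentum i]
    convert (h.smoothOn_density'.mul (h.smoothOn_comp' i)).hasDerivAt_integral isOpen_Ioo hs using 2
    funext x
    exact ((h.smoothOn_density'.hasDerivAt isOpen_Ioo hs x).mul
      ((h.smoothOn_comp' i).hasDerivAt isOpen_Ioo hs x)).deriv.symm) ht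

/-! ### Evolution of the energy and of the enstrophy -/

/-- Twice the kinetic energy. -/
def energy (ρ : ℝ → Plane → ℝ) (v : ℝ → Plane → Plane) (t : ℝ) : ℝ :=
  ∫ x, ρ t x * (comp v 0 t x ^ 2 + comp v 1 t x ^ 2) ∂torus

/-- Square of the `L²` norm of the velocity gradient. -/
def enstrophy (v : ℝ → Plane → Plane) (t : ℝ) : ℝ := gradSq (comp v 0 t) + gradSq (comp v 1 t)

lemma continuousOn_energy (h : IsSmoothSolution T ρ v P) :
    ContinuousOn (energy ρ v) (Set.Ico 0 T) :=
  (h.smoothOn_density.mul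
    (((h.smoothOn_comp 0).pow 2).add ((h.smoothOn_comp 1).pow 2))).continuousOn_integral

lemma hasDerivAt_energy (h : IsSmoothSolution T ρ v P) {t : ℝ} (ht : t ∈ Set.Ioo 0 T) :
    HasDerivAt (energy ρ v) (-2 * enstrophy v t) t := by
  unfold enstrophy
  rw [← (h.snapshot ht).integral_energy]
  change HasDerivAt (fun t => ∫ x, ρ t x * (comp v 0 t x ^ 2 + comp v 1 t x ^ 2) ∂torus) _ t
  convert (h.smoothOn_density'.mul
    (((h.smoothOn_comp' 0).pow 2).add ((h.smoothOn_comp' 1).pow 2))).hasDerivAt_integral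
      isOpen_Ioo ht using 2
  funext x
  have h0 := (h.smoothOn_comp' 0).hasDerivAt isOpen_Ioo ht x
  have h1 := (h.smoothOn_comp' 1).hasDerivAt isOpen_Ioo ht x
  have := ((h.smoothOn_density'.hasDerivAt isOpen_Ioo ht x).mul ((h0.pow 2).add (h1.pow 2))).deriv
  refine Eq.trans ?_ this.symm
  simp
  ring

lemma energy_nonneg (hρ : ∀ t ∈ Set.Ico 0 T, ∀ x, 0 ≤ ρ t x) {t : ℝ}
    (ht : t ∈ Set.Ico 0 T) : 0 ≤ energy ρ v t :=
  integral_nonneg fun x => mul_nonneg (hρ t ht x) (by positivity)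

lemma enstrophy_nonneg (v : ℝ → Plane → Plane) (t : ℝ) : 0 ≤ enstrophy v t :=
  add_nonneg (gradSq_nonneg _) (gradSq_nonneg _)

lemma energy_le (h : IsSmoothSolution T ρ v P) {t : ℝ} (ht : t ∈ Set.Ico 0 T) :
    energy ρ v t ≤ energy ρ v 0 := by
  have hd : ∀ s ∈ interior (Set.Ico 0 T), HasDerivAt (energy ρ v) (-2 * enstrophy v s) s :=
    fun s hs => h.hasDerivAt_energy (by rwa [interior_Ico] at hs)
  refine antitoneOn_of_deriv_nonpos (convex_Ico 0 T) h.continuousOn_energy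
    (fun s hs => (hd s hs).differentiableAt.differentiableWithinAt) (fun s hs => ?_)
    ⟨le_rfl, ht.1.trans_lt ht.2⟩ ht ht.1
  rw [(hd s hs).deriv]
  linarith [enstrophy_nonneg v s]

lemma continuous_pd_comp (h : IsSmoothSolution T ρ v P) {t : ℝ} (ht : t ∈ Set.Ico 0 T)
    (k i : Fin 2) : Continuous (pd k (comp v i t)) := ((h.smoothOn_pd_comp k i).slice ht).continuous

lemma enstrophy_eq (h : IsSmoothSolution T ρ v P) {t : ℝ} (ht : t ∈ Set.Ico 0 T) :
    enstrophy v t = ∫ x, (pd 0 (comp v 0 t) x ^ 2 + pd 1 (comp v 0 t) x ^ 2)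
      + (pd 0 (comp v 1 t) x ^ 2 + pd 1 (comp v 1 t) x ^ 2) ∂torus := by
  have := h.continuous_pd_comp ht
  rw [integral_add (integrable_torus (by fun_prop)) (integrable_torus (by fun_prop))]
  rfl

lemma continuousOn_enstrophy (h : IsSmoothSolution T ρ v P) :
    ContinuousOn (enstrophy v) (Set.Ico 0 T) :=
  ((((h.smoothOn_pd_comp 0 0).pow 2).add ((h.smoothOn_pd_comp 1 0).pow 2)).add
    (((h.smoothOn_pd_comp 0 1).pow 2).add
      ((h.smoothOn_pd_comp 1 1).pow 2))).continuousOn_integral.congr fun _ ht => h.enstrophy_eq ht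

lemma hasDerivAt_enstrophy (h : IsSmoothSolution T ρ v P) {t : ℝ} (ht : t ∈ Set.Ioo 0 T) :
    HasDerivAt (enstrophy v) (∫ x, -2 * ρ t x * (dt (comp v 0) t x * (dt (comp v 0) t x
      + conv (fun i => comp v i t) 0 x) + dt (comp v 1) t x * (dt (comp v 1) t x
      + conv (fun i => comp v i t) 1 x)) ∂torus) t := by
  rw [← (h.snapshot ht).integral_gradient_energy]
  have h1 := ((((h.smoothOn_pd_comp' 0 0).pow 2).add ((h.smoothOn_pd_comp' 1 0).pow 2)).add
    (((h.smoothOn_pd_comp' 0 1).pow 2).add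
      ((h.smoothOn_pd_comp' 1 1).pow 2))).hasDerivAt_integral isOpen_Ioo ht
  have h2 := h1.congr_of_eventuallyEq (f₁ := enstrophy v) (by
    filter_upwards [isOpen_Ioo.mem_nhds ht] with s hs
    exact h.enstrophy_eq (Set.Ioo_subset_Ico_self hs))
  refine h2.congr_deriv (integral_congr_ae (Filter.Eventually.of_forall fun x => ?_))
  have hd := fun k i => ((h.smoothOn_pd_comp' k i).hasDerivAt isOpen_Ioo ht x).pow 2
  have := (((hd 0 0).add (hd 1 0)).add ((hd 0 1).add (hd 1 1))).deriv
  refine Eq.trans this ?_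
  simp only [(h.smoothOn_comp' _).dt_pd isOpen_Ioo ht]
  norm_num
  ring

/-- The dissipation of the gradient estimate. -/
def dissipation (ρ : ℝ → Plane → ℝ) (v : ℝ → Plane → Plane) (P : ℝ → Plane → ℝ) (s t : ℝ) : ℝ :=
  (∫ x, ρ t x * (dt (comp v 0) t x ^ 2 + dt (comp v 1) t x ^ 2) ∂torus)
    + 1 / s * ((hessSq (comp v 0 t) + hessSq (comp v 1 t)) + gradSq (P t))

lemma continuousOn_dissipation (h : IsSmoothSolution T ρ v P) (s : ℝ) :
    ContinuousOn (dissipation ρ v P s) (Set.Ioo 0 T) := by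
  have hint : ∀ {G : ℝ → Plane → ℝ}, SmoothOn (Set.Ioo 0 T) G →
      ContinuousOn (fun t => ∫ x, G t x ∂torus) (Set.Ioo 0 T) := fun hG t ht =>
    (hG.hasDerivAt_integral isOpen_Ioo ht).continuousAt.continuousWithinAt
  have hdt := fun i => (h.smoothOn_comp' i).dt isOpen_Ioo
  have hpp := fun j k i => (h.smoothOn_pd_comp' k i).pd isOpen_Ioo.uniqueDiffOn j
  -- No regularity in time is assumed of the pressure; that of its gradient is read off the momentum
  -- equation.
  have hp : ∀ i, SmoothOn (Set.Ioo 0 T) fun t => pd i (P t) := fun i => by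
    refine (((hpp 0 0 i).add (hpp 1 1 i)).sub (h.smoothOn_density'.mul ((hdt i).add
      (((h.smoothOn_comp' 0).mul (h.smoothOn_pd_comp' 0 i)).add
        ((h.smoothOn_comp' 1).mul (h.smoothOn_pd_comp' 1 i)))))).congr fun t ht x => ?_
    rw [(h.snapshot ht).pd_p_eq i]
    simp only [lap_eq]
    rfl
  have hh := fun i => hint (((((hpp 0 0 i).pow 2).add ((hpp 1 0 i).pow 2)).add
    ((hpp 0 1 i).pow 2)).add ((hpp 1 1 i).pow 2))
  have hg := hint (((hp 0).pow 2).add ((hp 1).pow 2))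
  have ha := hint (h.smoothOn_density'.mul (((hdt 0).pow 2).add ((hdt 1).pow 2)))
  exact ha.add (continuousOn_const.mul (((hh 0).add (hh 1)).add hg))

lemma dissipation_nonneg (hρ : ∀ t ∈ Set.Ico 0 T, ∀ x, 0 ≤ ρ t x) {s : ℝ} (hs : 0 < s)
    {t : ℝ} (ht : t ∈ Set.Ico 0 T) : 0 ≤ dissipation ρ v P s t := by
  have h1 := hessSq_nonneg (comp v 0 t)
  have h2 := hessSq_nonneg (comp v 1 t)
  have h3 := gradSq_nonneg (P t)
  have h4 : 0 ≤ ∫ x, ρ t x * (dt (comp v 0) t x ^ 2 + dt (comp v 1) t x ^ 2) ∂torus :=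
    integral_nonneg fun x => mul_nonneg (hρ t ht x) (by positivity)
  unfold dissipation
  positivity

/-- The variance of the density is conserved, and is a function of the mass and the L² norm of the
initial density. -/
lemma integral_sq_mass_sub (h : IsSmoothSolution T ρ v P) {t : ℝ} (ht : t ∈ Set.Ico 0 T) :
    ∫ x, (mass (ρ 0) - ρ t x) ^ 2 ∂torus = (∫ x, ρ 0 x ^ 2 ∂torus) - mass (ρ 0) ^ 2 := by
  have hc := (h.smoothOn_density.slice ht).continuous
  have : (fun x => (mass (ρ 0) - ρ t x) ^ 2)
      = fun x => (ρ t x ^ 2 + mass (ρ 0) ^ 2) - 2 * mass (ρ 0) * ρ t x := by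
    funext x
    ring
  rw [this, integral_sub (integrable_torus (by fun_prop)) (integrable_torus (by fun_prop)),
    integral_add (integrable_torus (by fun_prop)) (integrable_torus (by fun_prop)),
    integral_const_mul, h.integral_density ht, h.integral_density_sq ht]
  simp
  ring

lemma bound_pos (h : IsSmoothSolution T ρ v P) {s : ℝ}
    (hρ : ∀ t ∈ Set.Ico 0 T, ∀ x, 0 ≤ ρ t x ∧ ρ t x ≤ s) (hM : 0 < mass (ρ 0)) {t : ℝ}
    (ht : t ∈ Set.Ico 0 T) : 0 < s := by
  have h0 : (0 : ℝ) ∈ Set.Ico 0 T := ⟨le_rfl, ht.1.trans_lt ht.2⟩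
  have := integral_mono (μ := torus) (f := ρ 0) (g := fun _ => s)
    (integrable_torus (h.smoothOn_density.slice h0).continuous)
    (integrable_const _) fun x => (hρ 0 h0 x).2
  simp only [integral_const, probReal_univ, one_smul] at this
  exact hM.trans_le this

/-- Propagation of the gradient. -/
lemma enstrophy_bound (h : IsSmoothSolution T ρ v P) {s : ℝ}
    (hρ : ∀ t ∈ Set.Ico 0 T, ∀ x, 0 ≤ ρ t x ∧ ρ t x ≤ s) (hM : 0 < mass (ρ 0)) {t : ℝ}
    (ht : t ∈ Set.Ico 0 T) :
    enstrophy v t + 1 / 2 * ∫ τ in (0 : ℝ)..t, dissipation ρ v P s τ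
      ≤ (Real.exp 1 + enstrophy v 0) ^ Real.exp (growthConst (mass (ρ 0))
          (((∫ x, ρ 0 x ^ 2 ∂torus) - mass (ρ 0) ^ 2) / mass (ρ 0) ^ 2) (energy ρ v 0) s / 2
            * energy ρ v 0) - Real.exp 1 := by
  have hs := h.bound_pos hρ hM ht
  have h0 : (0 : ℝ) ∈ Set.Ico 0 T := ⟨le_rfl, ht.1.trans_lt ht.2⟩
  have hρ0 : ∀ t ∈ Set.Ico 0 T, ∀ x, 0 ≤ ρ t x := fun t ht x => (hρ t ht x).1
  have hK : 0 ≤ growthConst (mass (ρ 0))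
      (((∫ x, ρ 0 x ^ 2 ∂torus) - mass (ρ 0) ^ 2) / mass (ρ 0) ^ 2) (energy ρ v 0) s := by
    rw [← h.integral_sq_mass_sub h0]
    have h1 : 0 ≤ energy ρ v 0 := energy_nonneg hρ0 h0
    have h2 : 0 ≤ ∫ x, (mass (ρ 0) - ρ 0 x) ^ 2 ∂torus := integral_nonneg fun x => sq_nonneg _
    unfold growthConst
    positivity
  refine gradient_bound_of_differential_inequality hK (fun t _ => enstrophy_nonneg v t)
    (fun t ht => energy_nonneg hρ0 ht) h.continuousOn_enstrophy h.continuousOn_energy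
    (fun t ht => dissipation_nonneg hρ0 hs (Set.Ioo_subset_Ico_self ht))
    (h.continuousOn_dissipation s) (fun t ht => h.hasDerivAt_enstrophy ht)
    (fun t ht => h.hasDerivAt_energy ht) (fun t ht => ?_) ht
  have ht' := Set.Ioo_subset_Ico_self ht
  -- Conservation of the variance and decay of the energy freeze the growth constant at its initial
  -- value.
  have := (h.snapshot ht).gradient_inequality (hρ0 t ht') (h.integral_density ht') hM
    (fun x => (hρ t ht' x).2) hs rfl rfl (h.energy_le ht')
  rw [h.integral_sq_mass_sub ht'] at this
  exact this

/-! ### Norms of the solution -/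

lemma normLp_gradV_sq (h : IsSmoothSolution T ρ v P) {t : ℝ} (ht : t ∈ Set.Ico 0 T) :
    normLp 2 (gradV (v t)) ^ 2 = enstrophy v t :=
  INS.normLp_gradV_sq fun i => ((h.smoothOn_comp i).slice ht).of_le one_le

lemma weightedNorm_velocity_sq (h : IsSmoothSolution T ρ v P)
    (hρ : ∀ t ∈ Set.Ico 0 T, ∀ x, 0 ≤ ρ t x) {t : ℝ} (ht : t ∈ Set.Ico 0 T) :
    weightedNorm (ρ t) (v t) ^ 2 = energy ρ v t :=
  weightedNorm_sq (h.smoothOn_density.slice ht).continuous (hρ t ht)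
    fun i => ((h.smoothOn_comp i).slice ht).continuous

lemma normLp_density_sq (h : IsSmoothSolution T ρ v P) {t : ℝ} (ht : t ∈ Set.Ico 0 T) :
    normLp 2 (ρ t) ^ 2 = ∫ x, ρ t x ^ 2 ∂torus := by
  rw [normLp_two_sq (h.smoothOn_density.slice ht).continuous]
  simp

lemma dissipation_eq (h : IsSmoothSolution T ρ v P)
    (hρ : ∀ t ∈ Set.Ico 0 T, ∀ x, 0 ≤ ρ t x) (s : ℝ) {t : ℝ} (ht : t ∈ Set.Ioo 0 T) :
    weightedNorm (ρ t) (dt v t) ^ 2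
      + 1 / s * (normLp 2 (hessV (v t)) ^ 2 + normLp 2 (grad (P t)) ^ 2)
      = dissipation ρ v P s t := by
  have ht' := Set.Ioo_subset_Ico_self ht
  have hS := h.snapshot ht
  have ha : ∀ i, (fun x => dt v t x i) = dt (comp v i) t := fun i => funext fun x => h.dt_apply ht x i
  rw [weightedNorm_sq hS.smooth_r.continuous (hρ t ht')
      (fun i => by rw [ha]; exact (hS.smooth_a i).continuous),
    normLp_hessV_sq (fun i => (hS.smooth_u i).of_le two_le), normLp_grad_sq hS.contDiff_p]
  simp only [h.dt_apply ht]
  rfl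

end IsSmoothSolution

/-! ### Bounds in Lebesgue spaces -/

/-- On a probability space the L^p norms increase with p, so it suffices to treat an even exponent
2n ≥ p. -/
lemma exists_normLp_sub_mean_le {p : ℝ≥0∞} (hp : p < ⊤) :
    ∃ C : ℝ, 0 ≤ C ∧ ∀ f : Plane → ℝ, ContDiff ℝ 1 f →
      normLp p (fun x => f x - ∫ y, f y ∂torus) ≤ C * √(gradSq f) := by
  obtain ⟨n, hn⟩ := ENNReal.exists_nat_gt hp.ne
  have hn1 : 0 < n := Nat.pos_of_ne_zero fun h0 => by simp [h0] at hn
  refine ⟨(n + 2).factorial, by positivity, fun f hf => ?_⟩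
  have hfc := hf.continuous
  set w := fun x => f x - ∫ y, f y ∂torus with hw
  have hwc : Continuous w := by fun_prop
  have hX := gradSq_nonneg f
  set q : ℝ≥0∞ := ((2 * n : ℕ) : ℝ≥0∞) with hq
  have hpq : p ≤ q := by
    refine hn.le.trans ?_
    rw [hq]
    exact_mod_cast (by omega : n ≤ 2 * n)
  have h1 : normLp p w ≤ normLp q w := by
    unfold normLp
    rw [← toReal_eLpNorm hwc.aestronglyMeasurable, ← toReal_eLpNorm hwc.aestronglyMeasurable]
    exact ENNReal.toReal_mono (memLp_torus hwc q).2.ne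
      (eLpNorm_le_eLpNorm_of_exponent_le hpq hwc.aestronglyMeasurable)
  refine h1.trans ?_
  have h2 : normLp q w ^ (2 * n) = ∫ x, w x ^ (2 * n) ∂torus := by
    unfold normLp
    have hq0 : q ≠ 0 := by
      rw [hq]
      exact_mod_cast (by omega : 2 * n ≠ 0)
    rw [lpNorm_eq_integral_norm_rpow_toReal hq0 (ENNReal.natCast_ne_top _)
      hwc.aestronglyMeasurable, hq, ENNReal.toReal_natCast,
      Real.rpow_inv_natCast_pow (integral_nonneg fun x => by positivity) (by omega)]
    congr 1
    funext x
    rw [Real.rpow_natCast, Real.norm_eq_abs, (even_two_mul n).pow_abs]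
  refine le_of_pow_le_pow_left₀ (n := 2 * n) (by omega) (by positivity) ?_
  rw [h2, mul_pow, pow_mul (√_), Real.sq_sqrt hX]
  refine (integral_sub_mean_pow_le hf n).trans ?_
  gcongr
  · exact_mod_cast Nat.one_le_iff_ne_zero.2 (Nat.factorial_ne_zero _)
  · omega

/-- Integration of a vector field commutes with taking components. -/
lemma integral_apply {w : Plane → Plane} (hw : Continuous w) (i : Fin 2) :
    (∫ x, w x ∂torus) i = ∫ x, w x i ∂torus :=
  ((EuclideanSpace.proj i : Plane →L[ℝ] ℝ).integral_comp_comm (integrable_torus hw)).symm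

lemma norm_le_abs_add_abs (a : Plane) : ‖a‖ ≤ |a 0| + |a 1| := by
  rw [EuclideanSpace.norm_eq, Fin.sum_univ_two]
  refine Real.sqrt_le_iff.2 ⟨by positivity, ?_⟩
  simp only [Real.norm_eq_abs]
  nlinarith [mul_nonneg (abs_nonneg (a 0)) (abs_nonneg (a 1))]

lemma norm_mean_le {r : Plane → ℝ} {w : Plane → Plane} (hr : Continuous r)
    (hw : ∀ i, ContDiff ℝ 1 fun x => w x i) {M : ℝ} (hM : ∫ x, r x ∂torus = M) (hM0 : 0 < M) :
    ‖∫ x, w x ∂torus‖ ≤ 1 / M * ‖∫ x, r x • w x ∂torus‖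
      + 1 / M * (4 * normLp 2 (fun x => M - r x) * normLp 2 (gradV w)) := by
  have hwc := continuous_of_components fun i => (hw i).continuous
  set Q := normLp 2 (fun x => M - r x)
  set G := normLp 2 (gradV w)
  have hQ0 : 0 ≤ Q := lpNorm_nonneg
  have hG0 : 0 ≤ G := lpNorm_nonneg
  have hQ : ∫ x, (M - r x) ^ 2 ∂torus = Q ^ 2 := by
    rw [normLp_two_sq (by fun_prop)]
    simp
  have hG : G ^ 2 = gradSq (fun x => w x 0) + gradSq (fun x => w x 1) := normLp_gradV_sq hw
  -- Z is the covariance of the density and the field. Cauchy–Schwarz and Poincaré bound each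
  -- component by √2 QG, rounded up to 2QG, and the two components give 4QG.
  set Z := M • (∫ x, w x ∂torus) - ∫ x, r x • w x ∂torus with hZ
  have hZi : ∀ i, |Z i| ≤ 2 * Q * G := by
    intro i
    have hwi := (hw i).continuous
    have e1 := integral_mul_eq_mean_add hr hwi
    have e2 : Z i = ∫ x, (M - r x) * (w x i - ∫ y, w y i ∂torus) ∂torus := by
      have e3 : (∫ x, r x • w x ∂torus) i = ∫ x, r x * w x i ∂torus :=
        integral_apply (hr.smul hwc) i
      rw [hM] at e1
      simp only [hZ, PiLp.sub_apply, PiLp.smul_apply, integral_apply hwc, e3, smul_eq_mul]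
      linarith
    have e3 := sq_integral_mul_le_torus (f := fun x => M - r x)
      (g := fun x => w x i - ∫ y, w y i ∂torus) (by fun_prop) (by fun_prop)
    rw [← e2, hQ] at e3
    have e4 := integral_sq_sub_mean_le (hw i)
    have e5 : gradSq (fun x => w x i) ≤ G ^ 2 := by
      rw [hG]
      fin_cases i
      · simpa using gradSq_nonneg (fun x => w x 1)
      · simpa using gradSq_nonneg (fun x => w x 0)
    refine abs_le_of_sq_le_sq ?_ (by positivity)
    refine e3.trans ((mul_le_mul_of_nonneg_left (e4.trans
      (mul_le_mul_of_nonneg_left e5 zero_le_two)) (sq_nonneg Q)).trans ?_)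
    nlinarith [mul_nonneg (sq_nonneg Q) (sq_nonneg G)]
  have hZn : ‖Z‖ ≤ 4 * Q * G := (norm_le_abs_add_abs Z).trans (by linarith [hZi 0, hZi 1])
  have e1 : ∫ x, w x ∂torus = (1 / M) • ((∫ x, r x • w x ∂torus) + Z) := by
    rw [hZ, add_sub_cancel, smul_smul, one_div, inv_mul_cancel₀ hM0.ne', one_smul]
  rw [e1, norm_smul, Real.norm_of_nonneg (by positivity), ← mul_add]
  gcongr
  exact (norm_add_le _ _).trans (by gcongr)

lemma normLp_le_norm_mean_add {p : ℝ≥0∞} (hp1 : 1 ≤ p) (hp : p < ⊤) {w : Plane → Plane}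
    (hw : ∀ i, Continuous fun x => w x i) :
    normLp p w ≤ ‖∫ x, w x ∂torus‖ + (normLp p (fun x => w x 0 - ∫ y, w y 0 ∂torus)
      + normLp p (fun x => w x 1 - ∫ y, w y 1 ∂torus)) := by
  have hwc := continuous_of_components hw
  have hw0 := hw 0
  have hw1 := hw 1
  set m := ∫ x, w x ∂torus with hm
  set f : Fin 2 → Plane → ℝ := fun i x => w x i - ∫ y, w y i ∂torus with hf
  have hfc : ∀ i, Continuous (f i) := fun i => (hw i).sub continuous_const
  have hp0 : p ≠ 0 := (zero_lt_one.trans_le hp1).ne'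
  have e1 : normLp p (fun x => w x - m) ≤ normLp p (f 0) + normLp p (f 1) := by
    have e2 : normLp p (fun x => w x - m) ≤ lpNorm ((fun x => |f 0 x|) + fun x => |f 1 x|) p torus :=
      lpNorm_mono_real (memLp_torus (by fun_prop) p) fun x => by
        have := norm_le_abs_add_abs (w x - m)
        simp only [PiLp.sub_apply, hm, integral_apply hwc] at this
        exact this
    refine e2.trans ((lpNorm_add_le (memLp_torus (by fun_prop) p) hp1).trans (le_of_eq ?_))
    rw [lpNorm_fun_abs (hfc 0).aestronglyMeasurable, lpNorm_fun_abs (hfc 1).aestronglyMeasurable]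
    rfl
  have e2 : normLp p w ≤ lpNorm (fun _ : Plane => m) p torus + normLp p (fun x => w x - m) := by
    have e3 : w = (fun _ => m) + fun x => w x - m := by
      funext x
      simp
    conv_lhs => rw [e3]
    exact lpNorm_add_le (memLp_torus continuous_const p) hp1
  have e3 : lpNorm (fun _ : Plane => m) p torus = ‖m‖ := by
    rw [lpNorm_const' hp0 hp.ne]
    simp
  rw [e3] at e2
  linarith

/-! ### The Lebesgue bound of the velocity -/

namespace IsSmoothSolution

variable {T : ℝ} {ρ : ℝ → Plane → ℝ} {v : ℝ → Plane → Plane} {P : ℝ → Plane → ℝ}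

lemma integral_momentum_eq (h : IsSmoothSolution T ρ v P) {t : ℝ} (ht : t ∈ Set.Ico 0 T) :
    ∫ x, ρ t x • v t x ∂torus = ∫ x, ρ 0 x • v 0 x ∂torus := by
  have hc : ∀ s ∈ Set.Ico 0 T, Continuous fun x => ρ s x • v s x := fun s hs =>
    (h.smoothOn_density.slice hs).continuous.smul
      (continuous_of_components fun i => ((h.smoothOn_comp i).slice hs).continuous)
  ext i
  rw [integral_apply (hc t ht), integral_apply (hc 0 ⟨le_rfl, ht.1.trans_lt ht.2⟩)]
  exact h.integral_density_mul_comp i ht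

lemma normLp_mass_sub (h : IsSmoothSolution T ρ v P) {t : ℝ} (ht : t ∈ Set.Ico 0 T) :
    normLp 2 (fun x => mass (ρ 0) - ρ t x) = normLp 2 (fun x => mass (ρ 0) - ρ 0 x) := by
  have h0 : (0 : ℝ) ∈ Set.Ico 0 T := ⟨le_rfl, ht.1.trans_lt ht.2⟩
  have hc : ∀ s ∈ Set.Ico 0 T, normLp 2 (fun x => mass (ρ 0) - ρ s x) ^ 2
      = (∫ x, ρ 0 x ^ 2 ∂torus) - mass (ρ 0) ^ 2 := fun s hs => by
    have hcs := (h.smoothOn_density.slice hs).continuous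
    rw [← h.integral_sq_mass_sub hs, normLp_two_sq (by fun_prop)]
    simp
  exact (pow_left_inj₀ lpNorm_nonneg lpNorm_nonneg two_ne_zero).1 ((hc t ht).trans (hc 0 h0).symm)

lemma normLp_velocity_le (h : IsSmoothSolution T ρ v P) (hM : 0 < mass (ρ 0)) {p : ℝ≥0∞}
    (hp1 : 1 ≤ p) (hp : p < ⊤) {C : ℝ} (hC0 : 0 ≤ C)
    (hC : ∀ f : Plane → ℝ, ContDiff ℝ 1 f →
      normLp p (fun x => f x - ∫ y, f y ∂torus) ≤ C * √(gradSq f))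
    {t : ℝ} (ht : t ∈ Set.Ico 0 T) :
    normLp p (v t) ≤ 1 / mass (ρ 0) * ‖∫ x, ρ 0 x • v 0 x ∂torus‖
      + (4 + 2 * C) * (1 + normLp 2 (fun x => mass (ρ 0) - ρ 0 x) / mass (ρ 0))
        * normLp 2 (gradV (v t)) := by
  have hw : ∀ i, ContDiff ℝ 1 fun x => v t x i := fun i =>
    ((h.smoothOn_comp i).slice ht).of_le one_le
  have e1 := normLp_le_norm_mean_add hp1 hp fun i => (hw i).continuous
  have e2 := norm_mean_le (h.smoothOn_density.slice ht).continuous hw (h.integral_density ht) hM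
  rw [h.integral_momentum_eq ht, h.normLp_mass_sub ht] at e2
  have hG := INS.normLp_gradV_sq hw
  have hG0 : 0 ≤ normLp 2 (gradV (v t)) := lpNorm_nonneg
  have hQ0 : 0 ≤ normLp 2 (fun x => mass (ρ 0) - ρ 0 x) := lpNorm_nonneg
  have e3 : ∀ i, normLp p (fun x => v t x i - ∫ y, v t y i ∂torus)
      ≤ C * normLp 2 (gradV (v t)) := fun i => by
    refine (hC _ (hw i)).trans (mul_le_mul_of_nonneg_left (Real.sqrt_le_iff.2 ⟨hG0, ?_⟩) hC0)
    rw [hG]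
    fin_cases i
    · simpa using gradSq_nonneg (fun x => v t x 1)
    · simpa using gradSq_nonneg (fun x => v t x 0)
  have e4 := e3 0
  have e5 := e3 1
  set G := normLp 2 (gradV (v t))
  set Q := normLp 2 (fun x => mass (ρ 0) - ρ 0 x)
  have e6 : 1 / mass (ρ 0) * (4 * Q * G) = 4 * (Q / mass (ρ 0)) * G := by ring
  have e7 : 0 ≤ Q / mass (ρ 0) * G := by positivity
  have e8 : 0 ≤ C * (Q / mass (ρ 0) * G) := by positivity
  rw [e6] at e2
  nlinarith

end IsSmoothSolution

end INS

end

/-- A real `T` loses nothing: a global solution restricts to every finite interval, and the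
constants do not depend on `T`. -/
theorem proposition3p1 :
    (∃ C₀ : ℝ → ℝ → ℝ → ℝ → ℝ,
      ∀ (T ρstar : ℝ) (ρ : ℝ → INS.Plane → ℝ) (v : ℝ → INS.Plane → INS.Plane)
        (P : ℝ → INS.Plane → ℝ),
        INS.IsSmoothSolution T ρ v P →
        (∀ t ∈ Set.Ico 0 T, ∀ x, 0 ≤ ρ t x ∧ ρ t x ≤ ρstar) →
        0 < INS.mass (ρ 0) →
        ∀ t ∈ Set.Ico 0 T,
          INS.normLp 2 (INS.gradV (v t)) ^ 2
            + 1 / 2 * ∫ τ in (0 : ℝ)..t,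
                (INS.weightedNorm (ρ τ) (INS.dt v τ) ^ 2
                  + 1 / ρstar * (INS.normLp 2 (INS.hessV (v τ)) ^ 2
                      + INS.normLp 2 (INS.grad (P τ)) ^ 2))
          ≤ (Real.exp 1 + INS.normLp 2 (INS.gradV (v 0)) ^ 2)
                ^ Real.exp
                  (C₀ (INS.mass (ρ 0)) (INS.normLp 2 (ρ 0)) (INS.weightedNorm (ρ 0) (v 0)) ρstar
                    * INS.weightedNorm (ρ 0) (v 0) ^ 2)
              - Real.exp 1)
    ∧ (∀ p : ℝ≥0∞, 1 ≤ p → p < ⊤ →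
        ∃ C : ℝ,
          ∀ (T ρstar : ℝ) (ρ : ℝ → INS.Plane → ℝ) (v : ℝ → INS.Plane → INS.Plane)
            (P : ℝ → INS.Plane → ℝ),
            INS.IsSmoothSolution T ρ v P →
            (∀ t ∈ Set.Ico 0 T, ∀ x, 0 ≤ ρ t x ∧ ρ t x ≤ ρstar) →
            0 < INS.mass (ρ 0) →
            ∀ t ∈ Set.Ico 0 T,
              INS.normLp p (v t)
                ≤ 1 / INS.mass (ρ 0) * ‖∫ x, ρ 0 x • v 0 x ∂INS.torus‖
                  + C * (1 + INS.normLp 2 (fun x => INS.mass (ρ 0) - ρ 0 x) / INS.mass (ρ 0))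
                    * INS.normLp 2 (INS.gradV (v t))) := by
  -- The relative variance ‖M - ρ₀‖₂²/M² equals (‖ρ₀‖₂² - M²)/M², hence depends on the admitted data
  -- only. The factor 1/2 comes from E' = -2X.
  refine ⟨⟨fun M n w s => INS.growthConst M ((n ^ 2 - M ^ 2) / M ^ 2) (w ^ 2) s / 2, ?_⟩, ?_⟩
  · intro T s ρ v P h hρ hM t ht
    have h0 : (0 : ℝ) ∈ Set.Ico 0 T := ⟨le_rfl, ht.1.trans_lt ht.2⟩
    have hρ0 : ∀ t ∈ Set.Ico 0 T, ∀ x, 0 ≤ ρ t x := fun t ht x => (hρ t ht x).1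
    have hint : ∫ τ in (0 : ℝ)..t, (INS.weightedNorm (ρ τ) (INS.dt v τ) ^ 2
          + 1 / s * (INS.normLp 2 (INS.hessV (v τ)) ^ 2 + INS.normLp 2 (INS.grad (P τ)) ^ 2))
        = ∫ τ in (0 : ℝ)..t, INS.IsSmoothSolution.dissipation ρ v P s τ := by
      refine intervalIntegral.integral_congr_ae (Filter.Eventually.of_forall fun τ hτ => ?_)
      -- The half-open interval leaves out τ = 0, where the time derivative is not under control.
      rw [Set.uIoc_of_le ht.1] at hτ
      exact h.dissipation_eq hρ0 s ⟨hτ.1, hτ.2.trans_lt ht.2⟩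
    dsimp only
    rw [hint, h.normLp_gradV_sq ht, h.normLp_gradV_sq h0, h.weightedNorm_velocity_sq hρ0 h0,
      h.normLp_density_sq h0]
    exact h.enstrophy_bound hρ hM ht
  · intro p hp1 hp
    obtain ⟨C, hC0, hC⟩ := INS.exists_normLp_sub_mean_le hp
    exact ⟨4 + 2 * C, fun T s ρ v P h _ hM t ht => h.normLp_velocity_le hM hp1 hp hC0 hC ht⟩
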